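/- Let $d\ge 1$, $1\le k\le d$, and write $x=(x_1,x_2)\in\mathbb R^k\times\mathbb R^{d-k}$ and $\omega=(\omega_1,\omega_2)\in\mathbb R^k\times\mathbb R^{d-k}$ for $x,\omega\in\mathbb R^d$. For $f,g\in L^2(\mathbb R^d)$ the partial short-time Fourier transform in the first $k$ variables is defined for almost all $(x,\omega)\in\mathbb R^{2d}$ by $$V^k_gf(x,\omega)=\int_{\mathbb R^k} f(t,x_2)\,\overline{g(t-x_1,-\omega_2)}\,e^{-2\pi i t\cdot\omega_1}\,dt$$ (for $k=d$ the variables $x_2,\omega_2$ are absent). Let $1<p<\infty$, let $q$ be the conjugate exponent, $\frac1p+\frac1q=1$, and let $\alpha,\beta>0$ with $\alpha\beta\ge 1$. Put $\|x\|_p^p=\sum_{i=1}^d|x_i|^p$ and $\|\omega\|_q^q=\sum_{i=1}^d|\omega_i|^q$. If $f,g\in L^2(\mathbb R^d)$ satisfy $$\int_{\mathbb R^d}\int_{\mathbb R^d}|V^k_gf(x,\omega)|\,e^{\frac{\pi}{p}\alpha^p\|x\|_p^p}\,dx\,d\omega<\infty \quad\text{and}\quad \int_{\mathbb R^d}\int_{\mathbb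 R^d}|V^k_gf(x,\omega)|\,e^{\frac{\pi}{q}\beta^q\|\omega\|_q^q}\,dx\,d\omega<\infty,$$ then $f=0$ almost everywhere or $g=0$ almost everywhere. -/

import Mathlib

open MeasureTheory

noncomputable section

namespace PartialSTFT

/-- For `x = (x₁, x₂) ∈ ℝᵏ × ℝᵈ⁻ᵏ`, the component `x₁ ∈ ℝᵏ`. -/
def firstPart {d k : ℕ} (hk : k ≤ d) (x : Fin d → ℝ) : Fin k → ℝ :=
  fun i => x (Fin.castLE hk i)

/-- For `t ∈ ℝᵏ` and `y = (y₁, y₂) ∈ ℝᵏ × ℝᵈ⁻ᵏ`, the point `(t, y₂) ∈ ℝᵈ`. -/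
def glue {d k : ℕ} (t : Fin k → ℝ) (y : Fin d → ℝ) : Fin d → ℝ :=
  fun i => if h : (i : ℕ) < k then t ⟨i, h⟩ else y i

/-- The partial short-time Fourier transform in the first `k` variables,
`V^k_g f (x, ω) = ∫_{ℝᵏ} f(t, x₂) conj(g(t - x₁, -ω₂)) exp(-2πi t · ω₁) dt`
with `x = (x₁, x₂)` and `ω = (ω₁, ω₂)`. If `f, g ∈ L²(ℝᵈ)`, the integrand is integrable for almost
all `(x, ω)`, and changing `f`, `g` on null sets changes the value only on a null set. -/
def partialSTFT {d k : ℕ} (hk : k ≤ d) (g f : (Fin d → ℝ) → ℂ) (x ω : Fin d → ℝ) : ℂ :=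
  ∫ t : Fin k → ℝ,
    f (glue t x) * starRingEnd ℂ (g (glue (t - firstPart hk x) (-ω))) *
      Complex.exp (-(2 * Real.pi * Complex.I * ((∑ i, t i * firstPart hk ω i : ℝ) : ℂ)))

/-- The `p`-th power `‖x‖_p^p` of the `ℓᵖ`-norm on `ℝᵈ`. -/
def lpNormPow {d : ℕ} (p : ℝ) (x : Fin d → ℝ) : ℝ :=
  ∑ i, |x i| ^ p

end PartialSTFT

end

/-! Freezing the last `d - k` coordinates of `x` and of `ω` turns the partial transform into the
ordinary short-time Fourier transform of slices of `f` and `g` on `ℝᵏ` (`partialSTFT_splitEquiv`).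
Decay in one coordinate of the first block already suffices, so `stft_uncertainty` makes one slice
of almost every pair vanish. One slice is indexed by `x₂` alone and the other by `ω₂` alone, so `f`
or `g` itself vanishes (`ae_or_of_ae_ae_or`).

For the short-time Fourier transform `V` and a centre `w`, put `F(x, ω) = V(w + (x, ω)) V(w - (x,
ω)) exp(2πi ω · x)`. The Fourier transform of `F` in `ω` is a symmetric function of `x` and the dual
variable `u` (`integral_reflectedProduct_symm`). By convexity of `|t|ᵖ`, the two weights at the
reflected points dominate the square of the weight at `(x, ω)`, so for almost every `w` the function
`F` decays at the doubled rate. Symmetry turns decay of `F` in `x` into decay of the Fourier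
transform of `F(u, ·)`, which therefore satisfies Gelfand–Shilov's hypotheses and is zero.
Integrating over all centres gives `V = 0`, and Fourier inversion gives `f(t) conj(g(t - x)) = 0`.

In the Gelfand–Shilov principle one of the two exponents, say `q`, is at most two. The Fourier
transform `B` of a function with the `p`-weight is entire, is `O(exp(κ|Im z|^q))`, and is integrable
on the line against `exp(κ|x|^q)`. If `q < 2`, growth and decay cancel in `B(z) B(iz)`, whose
primitive is bounded on both axes, hence constant by Phragmén–Lindelöf and Liouville. If `q = 2`,
the same tools show that `exp(κz²) B(z)` is constant, and integrability makes it zero. Primitives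
enter because the decay is integral rather than pointwise. -/

/-! ### Vanishing of entire functions that grow off the real line and decay along it. -/

/-- A function bounded by an integrable function in derivative is bounded. -/
theorem norm_le_integral_of_hasDerivAt {h h' : ℝ → ℂ} {g : ℝ → ℝ}
    (hd : ∀ x, HasDerivAt h (h' x) x) (hc : Continuous h') (hg : Integrable g)
    (hle : ∀ x, ‖h' x‖ ≤ g x) (h0 : h 0 = 0) (x : ℝ) : ‖h x‖ ≤ ∫ t, g t := by
  have e := intervalIntegral.integral_eq_sub_of_hasDerivAt (fun t _ => hd t)
    (hc.intervalIntegrable 0 x)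
  rw [h0, sub_zero] at e
  rw [← e]
  calc ‖∫ t in (0:ℝ)..x, h' t‖ ≤ ∫ t in Set.uIoc 0 x, ‖h' t‖ :=
        intervalIntegral.norm_integral_le_integral_norm_uIoc
    _ ≤ ∫ t, ‖h' t‖ := by
        apply setIntegral_le_integral
        · exact hg.mono' hc.norm.aestronglyMeasurable (by simpa using Filter.Eventually.of_forall hle)
        · exact Filter.Eventually.of_forall fun t => norm_nonneg _
    _ ≤ ∫ t, g t := integral_mono
        (hg.mono' hc.norm.aestronglyMeasurable (by simpa using Filter.Eventually.of_forall hle)) hg hle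

/-- Phragmén–Lindelöf in the four quadrants: an entire function of order less than two that is
bounded on both axes is bounded. -/
theorem norm_le_of_bounded_on_axes {F : ℂ → ℂ} (hF : Differentiable ℂ F) {A D c M : ℝ}
    (hc : c < 2) (hgr : ∀ z, ‖F z‖ ≤ A * Real.exp (D * ‖z‖ ^ c))
    (hre : ∀ x : ℝ, ‖F x‖ ≤ M) (him : ∀ x : ℝ, ‖F (x * Complex.I)‖ ≤ M) (z : ℂ) : ‖F z‖ ≤ M := by
  have hO : ∀ l : Filter ℂ, ∃ c < (2:ℝ), ∃ B, F =O[l] fun z => Real.exp (B * ‖z‖ ^ c) := by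
    intro l
    refine ⟨c, hc, D, Asymptotics.IsBigO.of_bound A (Filter.Eventually.of_forall fun z => ?_)⟩
    rw [Real.norm_eq_abs, abs_of_pos (Real.exp_pos _)]
    exact hgr z
  rcases le_total 0 z.re with h1 | h1 <;> rcases le_total 0 z.im with h2 | h2
  · exact PhragmenLindelof.quadrant_I hF.diffContOnCl (hO _) (fun x _ => hre x)
      (fun x _ => him x) h1 h2
  · exact PhragmenLindelof.quadrant_IV hF.diffContOnCl (hO _) (fun x _ => hre x)
      (fun x _ => him x) h1 h2
  · exact PhragmenLindelof.quadrant_II hF.diffContOnCl (hO _) (fun x _ => hre x)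
      (fun x _ => him x) h1 h2
  · exact PhragmenLindelof.quadrant_III hF.diffContOnCl (hO _) (fun x _ => hre x)
      (fun x _ => him x) h1 h2

theorem norm_le_of_norm_deriv_le {F G : ℂ → ℂ} (hd : ∀ z, HasDerivAt F (G z) z) (h0 : F 0 = 0)
    {z : ℂ} {C : ℝ} (hC : ∀ t ∈ Set.Icc (0:ℝ) 1, ‖G (t * z)‖ ≤ C) : ‖F z‖ ≤ C * ‖z‖ := by
  have := Convex.norm_image_sub_le_of_norm_hasDerivWithin_le (f := F) (f' := G) (C := C)
    (s := segment ℝ 0 z) (x := 0) (y := z) (fun x _ => (hd x).hasDerivWithinAt) ?_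
    (convex_segment _ _) (left_mem_segment ℝ _ _) (right_mem_segment ℝ _ _)
  · simpa [h0] using this
  · intro x hx
    rw [segment_eq_image'] at hx
    obtain ⟨t, ht, rfl⟩ := hx
    simpa using hC t ht

/-- On either axis one factor of `B(z) B(iz)` sits on the real line and the other on the imaginary
line, so the growth bound of one is absorbed by the integrable decay of the other. -/
theorem eq_zero_of_growth_lt_two {B : ℂ → ℂ} (hB : Differentiable ℂ B) {q κ C : ℝ} (hq1 : 1 ≤ q)
    (hq2 : q < 2) (hκ : 0 ≤ κ) (hbd : ∀ z, ‖B z‖ ≤ C * Real.exp (κ * |z.im| ^ q))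
    (hint : Integrable fun x : ℝ => ‖B x‖ * Real.exp (κ * |x| ^ q)) (z : ℂ) : B z = 0 := by
  have hC : 0 ≤ C := by
    have := (norm_nonneg _).trans (hbd 0)
    exact nonneg_of_mul_nonneg_left this (Real.exp_pos _)
  set P : ℂ → ℂ := fun z => B z * B (Complex.I * z) with hP
  have hPd : Differentiable ℂ P := hB.mul (hB.comp (differentiable_id.const_mul _))
  obtain ⟨F, hF0, hF⟩ := hPd.isExactOn_univ.with_val_at 0 0
  replace hF : ∀ z, HasDerivAt F (P z) z := fun z => hF z trivial
  have hFd : Differentiable ℂ F := fun z => (hF z).differentiableAt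
  set M := ∫ t : ℝ, C * (‖B t‖ * Real.exp (κ * |t| ^ q)) with hM
  have hre : ∀ x : ℝ, ‖F x‖ ≤ M := by
    refine norm_le_integral_of_hasDerivAt (h := fun x : ℝ => F x) (h' := fun x : ℝ => P x)
      (fun x => (hF x).comp_ofReal) (hPd.continuous.comp Complex.continuous_ofReal)
      (hint.const_mul C) (fun x => ?_) (by simpa using hF0)
    have := hbd (Complex.I * x)
    simp only [Complex.mul_im, Complex.I_re, Complex.I_im, Complex.ofReal_re, Complex.ofReal_im] at this
    simp only [hP, norm_mul]
    calc _ ≤ ‖B x‖ * (C * Real.exp (κ * |x| ^ q)) := by gcongr; simpa using this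
      _ = _ := by ring
  have him : ∀ x : ℝ, ‖F (x * Complex.I)‖ ≤ M := by
    -- At `z = ix` the real factor is `B(-x)`, so the bound `M` is rewritten by the reflection `t ↦
    -- -t`.
    have hM' : M = ∫ t : ℝ, C * (‖B (-t : ℝ)‖ * Real.exp (κ * |-t| ^ q)) := by
      rw [hM]; exact (integral_neg_eq_self (fun t : ℝ => C * (‖B t‖ * Real.exp (κ * |t| ^ q))) volume).symm
    rw [hM']
    refine norm_le_integral_of_hasDerivAt (h := fun x : ℝ => F (x * Complex.I))
      (h' := fun x : ℝ => P (x * Complex.I) * Complex.I)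
      (fun x => ?_) ?_ (hint.comp_neg.const_mul C) (fun x => ?_) (by simpa using hF0)
    · have h2 : HasDerivAt (fun w : ℂ => w * Complex.I) Complex.I (x : ℂ) := by
        simpa using (hasDerivAt_id (x:ℂ)).mul_const Complex.I
      exact ((hF (x * Complex.I)).comp (x:ℂ) h2).comp_ofReal
    · have := hPd.continuous
      fun_prop
    · have := hbd (x * Complex.I)
      simp only [Complex.mul_im, Complex.I_re, Complex.I_im, Complex.ofReal_re, Complex.ofReal_im] at this
      have e : Complex.I * (x * Complex.I) = ((-x : ℝ) : ℂ) := by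
        push_cast; linear_combination (x:ℂ) * Complex.I_mul_I
      simp only [hP, norm_mul, e, Complex.norm_I, mul_one, abs_neg]
      calc _ ≤ (C * Real.exp (κ * |x| ^ q)) * ‖B ((-x : ℝ) : ℂ)‖ := by gcongr; simpa using this
        _ = _ := by ring
  have hgr : ∀ z, ‖F z‖ ≤ (C * C * Real.exp 1) * Real.exp ((2 * κ + 1) * ‖z‖ ^ q) := by
    intro z
    have h1 : ‖F z‖ ≤ (C * Real.exp (κ * ‖z‖ ^ q) * (C * Real.exp (κ * ‖z‖ ^ q))) * ‖z‖ := by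
      refine norm_le_of_norm_deriv_le hF hF0 fun t ht => ?_
      have hb : ∀ w : ℂ, ‖w‖ ≤ ‖z‖ → ‖B w‖ ≤ C * Real.exp (κ * ‖z‖ ^ q) := by
        intro w hw
        refine (hbd w).trans ?_
        have : |w.im| ≤ ‖z‖ := (Complex.abs_im_le_norm w).trans hw
        gcongr
      have hn : ‖(t:ℂ) * z‖ ≤ ‖z‖ := by
        rw [norm_mul, Complex.norm_real, Real.norm_eq_abs, abs_of_nonneg ht.1]
        exact mul_le_of_le_one_left (norm_nonneg _) ht.2
      simp only [hP, norm_mul]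
      gcongr
      · exact hb _ hn
      · exact hb _ (by simpa using hn)
    have h2 : ‖z‖ ≤ Real.exp (1 + ‖z‖ ^ q) := by
      have : ‖z‖ ≤ 1 + ‖z‖ ^ q := by
        rcases le_total ‖z‖ 1 with h | h
        · have : 0 ≤ ‖z‖ ^ q := by positivity
          linarith
        · have := Real.rpow_le_rpow_of_exponent_le h hq1
          rw [Real.rpow_one] at this; linarith
      exact this.trans (by linarith [Real.add_one_le_exp (1 + ‖z‖ ^ q)])
    calc _ ≤ _ := h1
      _ ≤ (C * Real.exp (κ * ‖z‖ ^ q) * (C * Real.exp (κ * ‖z‖ ^ q))) * Real.exp (1 + ‖z‖ ^ q) := by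
        gcongr
      _ = _ := by
        rw [show (2 * κ + 1) * ‖z‖ ^ q = κ * ‖z‖ ^ q + κ * ‖z‖ ^ q + ‖z‖ ^ q by ring,
          Real.exp_add, Real.exp_add, Real.exp_add]
        ring
  have hbdF := norm_le_of_bounded_on_axes hFd hq2 hgr hre him
  have hconst : ∀ w, F w = F 0 := fun w => hFd.apply_eq_apply_of_bounded
    (Metric.isBounded_closedBall (x := (0:ℂ)) (r := M) |>.subset
      (by rintro _ ⟨w, rfl⟩; simpa using hbdF w)) _ _
  have hP0 : ∀ w, P w = 0 := by
    intro w
    have : F = fun _ => F 0 := funext hconst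
    have h := hF w
    rw [this] at h
    exact h.unique (hasDerivAt_const _ _)
  have hBa : AnalyticOnNhd ℂ B Set.univ := fun w _ => hB.analyticAt w
  have hBa' : AnalyticOnNhd ℂ (fun w => B (Complex.I * w)) Set.univ := fun w _ =>
    (show Differentiable ℂ (fun w => B (Complex.I * w)) from
      hB.comp (differentiable_id.const_mul _)).analyticAt w
  -- By the identity theorem one of the two factors vanishes identically; they differ by a rotation.
  rcases hBa.eq_zero_or_eq_zero_of_mul_eq_zero hBa' (fun w _ => hP0 w) isPreconnected_univ
    with h | h
  · exact h z trivial
  · have := h (-Complex.I * z) trivial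
    simpa [← mul_assoc] using this

theorem norm_le_norm_one_add {z : ℂ} (hz : 0 ≤ z.re) : ‖z‖ ≤ ‖1 + z‖ ∧ 1 ≤ ‖1 + z‖ := by
  constructor
  · rw [Complex.norm_def, Complex.norm_def]
    apply Real.sqrt_le_sqrt
    simp only [Complex.normSq_apply, Complex.add_re, Complex.one_re, Complex.add_im, Complex.one_im]
    nlinarith
  · have := Complex.abs_re_le_norm (1 + z)
    simp only [Complex.add_re, Complex.one_re] at this
    rw [abs_of_nonneg (by linarith)] at this
    linarith

theorem re_exp_mul_of_sign {s : ℝ} (hs : s = 1 ∨ s = -1) (w : ℂ) :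
    (Complex.exp (s * w)).re = Real.exp (s * w.re) * Real.cos w.im := by
  rw [Complex.exp_re]
  rcases hs with rfl | rfl <;> simp

theorem norm_exp_mul_sq_of_sign {s : ℝ} (hs : s = 1 ∨ s = -1) (c : ℝ) (w : ℂ) :
    ‖Complex.exp (Complex.I * ((s * c : ℝ) : ℂ) * Complex.exp (s * w) ^ 2)‖ =
      Real.exp (-(c * Real.exp (s * w.re) ^ 2 * Real.sin (2 * w.im))) := by
  rw [Complex.norm_exp]
  congr 1
  rw [← Complex.exp_nat_mul, mul_assoc, Complex.mul_re, Complex.I_re, Complex.I_im,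
    Complex.re_ofReal_mul, Complex.im_ofReal_mul, Complex.exp_im, ← Real.exp_nat_mul]
  have h1 : (((2:ℕ):ℂ) * ((s:ℂ) * w)).re = ((2:ℕ):ℝ) * (s * w.re) := by simp
  have h2 : (((2:ℕ):ℂ) * ((s:ℂ) * w)).im = s * (2 * w.im) := by simp; ring
  rw [h1, h2]
  rcases hs with rfl | rfl
  · simp; ring
  · rw [show (-1:ℝ) * (2 * w.im) = -(2 * w.im) by ring, Real.sin_neg]; ring

/-- Phragmén–Lindelöf in the sector of opening `θ < π / 2`. -/
theorem norm_le_on_sector {H : ℂ → ℂ} (hH : Differentiable ℂ H) {κ C M : ℝ} (hκ : 0 ≤ κ)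
    (hC : 0 ≤ C) (hgr : ∀ z, ‖H z‖ ≤ C * Real.exp (κ * z.re ^ 2) * ‖z‖)
    (hre : ∀ x : ℝ, ‖H x‖ ≤ M) {s : ℝ} (hs : s = 1 ∨ s = -1) {θ : ℝ} (hθ0 : 0 < θ)
    (hθ : θ < Real.pi / 2) {w : ℂ} (hw0 : 0 ≤ w.im) (hw : w.im ≤ θ) :
    ‖H (Complex.exp (s * w)) / (1 + Complex.exp (s * w))‖ *
      Real.exp (-(κ * Real.cos θ / (2 * Real.sin θ) * Real.exp (s * w.re) ^ 2 *
        Real.sin (2 * w.im))) ≤ max M C := by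
  have hsin : 0 < Real.sin θ := Real.sin_pos_of_pos_of_lt_pi hθ0 (by linarith [Real.pi_pos])
  have hcos : 0 < Real.cos θ := Real.cos_pos_of_mem_Ioo ⟨by linarith, hθ⟩
  -- In `z = exp(sw)`, with `s = ±1` selecting the upper or lower sector, the auxiliary factor
  -- `exp(i s c z²)` has modulus `exp(-c|z|² sin(2 Im w))`. This `c` solves `κ cos² θ = c sin 2θ`,
  -- cancelling the growth on the ray `Im w = θ`. Division by `1 + z` removes the linear factor
  -- `‖z‖`.
  set c := κ * Real.cos θ / (2 * Real.sin θ) with hc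
  have hc0 : 0 ≤ c := by positivity
  set f : ℂ → ℂ := fun w => H (Complex.exp (s * w)) / (1 + Complex.exp (s * w)) *
    Complex.exp (Complex.I * ((s * c : ℝ) : ℂ) * Complex.exp (s * w) ^ 2) with hf
  have hfn : ∀ w, ‖f w‖ = ‖H (Complex.exp (s * w)) / (1 + Complex.exp (s * w))‖ *
      Real.exp (-(c * Real.exp (s * w.re) ^ 2 * Real.sin (2 * w.im))) := fun w => by
    rw [hf]; simp only [norm_mul, norm_exp_mul_sq_of_sign hs]
  have hrepos : ∀ w : ℂ, 0 ≤ w.im → w.im ≤ θ → 0 ≤ (Complex.exp (s * w)).re := by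
    intro w h0 h1
    rw [re_exp_mul_of_sign hs]
    exact mul_nonneg (Real.exp_pos _).le (Real.cos_nonneg_of_mem_Icc ⟨by linarith, by linarith⟩)
  have hquot : ∀ w : ℂ, 0 ≤ w.im → w.im ≤ θ →
      ‖H (Complex.exp (s * w)) / (1 + Complex.exp (s * w))‖ ≤
        C * Real.exp (κ * (Real.exp (s * w.re) * Real.cos w.im) ^ 2) := by
    intro w h0 h1
    obtain ⟨h2, h3⟩ := norm_le_norm_one_add (hrepos w h0 h1)
    rw [norm_div, div_le_iff₀ (by linarith), ← re_exp_mul_of_sign hs]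
    refine (hgr _).trans ?_
    gcongr
  rw [← hfn]
  refine PhragmenLindelof.horizontal_strip (a := 0) (b := θ) (f := f) ?_ ?_ ?_ ?_ hw0 hw
  · apply DifferentiableOn.diffContOnCl
    intro w hwc
    have hwc' : w ∈ Complex.im ⁻¹' Set.Icc 0 θ := by
      refine closure_minimal (t := Complex.im ⁻¹' Set.Icc 0 θ) ?_
        (isClosed_Icc.preimage Complex.continuous_im) hwc
      exact Set.preimage_mono Set.Ioo_subset_Icc_self
    have hne : 1 + Complex.exp (s * w) ≠ 0 := by
      have := (norm_le_norm_one_add (hrepos w hwc'.1 hwc'.2)).2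
      exact norm_pos_iff.mp (by linarith)
    apply DifferentiableAt.differentiableWithinAt
    have h1 : DifferentiableAt ℂ (fun w => H (Complex.exp (s * w))) w :=
      (hH _).comp w (by fun_prop)
    exact (h1.div (by fun_prop) hne).mul (by fun_prop)
  -- Order two is admissible because a strip of width `θ < π / 2` allows every order below `π / θ`.
  · refine ⟨2, ?_, κ, Asymptotics.IsBigO.of_bound C ?_⟩
    · rw [lt_div_iff₀ (by linarith)]; linarith
    · refine Filter.eventually_inf_principal.mpr (Filter.Eventually.of_forall fun w hw => ?_)
      have h0 : 0 ≤ w.im := hw.1.le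
      have h1 : w.im ≤ θ := hw.2.le
      rw [hfn, Real.norm_eq_abs, abs_of_pos (Real.exp_pos _)]
      have e1 : Real.exp (-(c * Real.exp (s * w.re) ^ 2 * Real.sin (2 * w.im))) ≤ 1 := by
        rw [Real.exp_le_one_iff, neg_nonpos]
        have : 0 ≤ Real.sin (2 * w.im) :=
          Real.sin_nonneg_of_nonneg_of_le_pi (by linarith) (by linarith)
        positivity
      refine (mul_le_of_le_one_right (norm_nonneg _) e1).trans ((hquot w h0 h1).trans ?_)
      gcongr
      rw [mul_pow, ← Real.exp_nat_mul]
      have h2 : Real.cos w.im ^ 2 ≤ 1 := Real.cos_sq_le_one _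
      have h3 : ((2:ℕ):ℝ) * (s * w.re) ≤ 2 * |w.re| := by
        have := le_abs_self w.re
        have := neg_abs_le w.re
        rcases hs with rfl | rfl <;> push_cast <;> linarith
      calc _ ≤ Real.exp (((2:ℕ):ℝ) * (s * w.re)) * 1 := by gcongr
        _ ≤ _ := by rw [mul_one]; gcongr
  · intro w hw0
    rw [hfn, hw0, mul_zero, Real.sin_zero, mul_zero, neg_zero, Real.exp_zero, mul_one]
    refine le_trans ?_ (le_max_left _ _)
    have hreal : Complex.exp (s * w) = ((Real.exp (s * w.re) : ℝ) : ℂ) := by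
      rw [Complex.ofReal_exp]; congr 1; apply Complex.ext <;> simp [hw0]
    obtain ⟨h2, h3⟩ := norm_le_norm_one_add (hrepos w hw0.ge (by linarith))
    rw [norm_div, div_le_iff₀ (by linarith)]
    have h4 := hre (Real.exp (s * w.re))
    rw [← hreal] at h4
    exact h4.trans (le_mul_of_one_le_right ((norm_nonneg _).trans h4) h3)
  · intro w hwθ
    rw [hfn]
    refine le_trans ?_ (le_max_right _ _)
    refine (mul_le_mul_of_nonneg_right (hquot w (by linarith) hwθ.le) (Real.exp_pos _).le).trans ?_
    rw [mul_assoc, ← Real.exp_add, hwθ]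
    have : κ * (Real.exp (s * w.re) * Real.cos θ) ^ 2 +
        -(c * Real.exp (s * w.re) ^ 2 * Real.sin (2 * θ)) = 0 := by
      rw [Real.sin_two_mul, hc]; field_simp; ring
    rw [this, Real.exp_zero, mul_one]

/-- The sector bound is uniform in `θ`, and its auxiliary exponent contains `cos θ`. Letting `θ`
increase to `π / 2` removes that factor and covers the open half-plane; on the imaginary axis the
growth hypothesis is itself linear. -/
theorem norm_le_on_right_half_plane {H : ℂ → ℂ} (hH : Differentiable ℂ H) {κ C M : ℝ} (hκ : 0 ≤ κ)
    (hC : 0 ≤ C) (hgr : ∀ z, ‖H z‖ ≤ C * Real.exp (κ * z.re ^ 2) * ‖z‖)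
    (hre : ∀ x : ℝ, ‖H x‖ ≤ M) {z : ℂ} (hz : 0 ≤ z.re) : ‖H z‖ ≤ max M C * (1 + ‖z‖) := by
  have hM : 0 ≤ max M C := hC.trans (le_max_right _ _)
  rcases hz.eq_or_lt with h0 | hpos
  · have := hgr z
    rw [← h0] at this
    simp only [ne_eq, OfNat.ofNat_ne_zero, not_false_eq_true, zero_pow, mul_zero, Real.exp_zero,
      mul_one] at this
    refine this.trans ?_
    gcongr
    · exact le_max_right _ _
    · linarith
  · have hz0 : z ≠ 0 := by rintro rfl; simp at hpos
    obtain ⟨s, hs, w, hw, hw0, hw1⟩ : ∃ s : ℝ, (s = 1 ∨ s = -1) ∧ ∃ w : ℂ,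
        Complex.exp (s * w) = z ∧ 0 ≤ w.im ∧ w.im < Real.pi / 2 := by
      have harg := Complex.abs_arg_lt_pi_div_two_iff.mpr (Or.inl hpos)
      rw [abs_lt] at harg
      rcases le_total 0 z.arg with h | h
      · exact ⟨1, Or.inl rfl, Complex.log z, by simp [Complex.exp_log hz0],
          by rwa [Complex.log_im], by rw [Complex.log_im]; exact harg.2⟩
      · exact ⟨-1, Or.inr rfl, -Complex.log z, by simp [Complex.exp_log hz0],
          by rwa [Complex.neg_im, Complex.log_im, neg_nonneg],
          by simp only [Complex.neg_im, Complex.log_im]; linarith [harg.1]⟩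
    have key : ‖H z / (1 + z)‖ ≤ max M C := by
      have hlim : Filter.Tendsto (fun θ : ℝ => ‖H (Complex.exp (s * w)) / (1 + Complex.exp (s * w))‖ *
          Real.exp (-(κ * Real.cos θ / (2 * Real.sin θ) * Real.exp (s * w.re) ^ 2 *
            Real.sin (2 * w.im)))) (nhdsWithin (Real.pi / 2) (Set.Iio (Real.pi / 2)))
          (nhds (‖H z / (1 + z)‖)) := by
        have : ContinuousAt (fun θ : ℝ => ‖H (Complex.exp (s * w)) / (1 + Complex.exp (s * w))‖ *
          Real.exp (-(κ * Real.cos θ / (2 * Real.sin θ) * Real.exp (s * w.re) ^ 2 *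
            Real.sin (2 * w.im)))) (Real.pi / 2) := by
          refine ContinuousAt.mul continuousAt_const (ContinuousAt.rexp (ContinuousAt.neg
            (ContinuousAt.mul (ContinuousAt.mul (ContinuousAt.div ?_ ?_ ?_) ?_) ?_)))
          all_goals first | fun_prop | simp
        have h := this.tendsto
        simp only [Real.cos_pi_div_two, mul_zero, zero_div, zero_mul, neg_zero, Real.exp_zero,
          mul_one, hw] at h
        exact (by simpa only [hw] using h.mono_left nhdsWithin_le_nhds)
      refine le_of_tendsto hlim ?_
      have : Set.Ioo w.im (Real.pi / 2) ∈ nhdsWithin (Real.pi / 2) (Set.Iio (Real.pi / 2)) :=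
        Ioo_mem_nhdsLT hw1
      filter_upwards [this] with θ hθ
      exact norm_le_on_sector hH hκ hC hgr hre hs (hw0.trans_lt hθ.1) hθ.2 hw0 hθ.1.le
    have h3 := (norm_le_norm_one_add hz).2
    rw [norm_div, div_le_iff₀ (by linarith)] at key
    refine key.trans ?_
    gcongr
    simpa using norm_add_le (1:ℂ) z

/-- The critical order-two case, the heart of Hardy's uncertainty principle. -/
theorem eq_zero_of_gaussian_growth {B : ℂ → ℂ} (hB : Differentiable ℂ B) {κ C : ℝ}
    (hκ : 0 ≤ κ) (hbd : ∀ z, ‖B z‖ ≤ C * Real.exp (κ * z.im ^ 2))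
    (hint : Integrable fun x : ℝ => ‖B x‖ * Real.exp (κ * x ^ 2)) (z : ℂ) : B z = 0 := by
  have hC : 0 ≤ C := nonneg_of_mul_nonneg_left ((norm_nonneg _).trans (hbd 0)) (Real.exp_pos _)
  -- The factor `exp(κz²)` trades growth in `Im z` for growth in `Re z` and absorbs the weight on
  -- the real line.
  set G : ℂ → ℂ := fun z => Complex.exp (κ * z ^ 2) * B z with hG
  have hGd : Differentiable ℂ G := by fun_prop
  have hGn : ∀ z, ‖G z‖ = Real.exp (κ * (z.re ^ 2 - z.im ^ 2)) * ‖B z‖ := by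
    intro z
    rw [hG, norm_mul, Complex.norm_exp, Complex.re_ofReal_mul, sq, Complex.mul_re]
    simp only [sq]
  have hGb : ∀ z, ‖G z‖ ≤ C * Real.exp (κ * z.re ^ 2) := by
    intro z
    rw [hGn]
    refine (mul_le_mul_of_nonneg_left (hbd z) (Real.exp_pos _).le).trans_eq ?_
    rw [mul_left_comm, ← Real.exp_add]; ring_nf
  obtain ⟨H, hH0, hH⟩ := hGd.isExactOn_univ.with_val_at 0 0
  replace hH : ∀ z, HasDerivAt H (G z) z := fun z => hH z trivial
  have hHd : Differentiable ℂ H := fun z => (hH z).differentiableAt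
  have hGr : ∀ x : ℝ, ‖G x‖ = ‖B x‖ * Real.exp (κ * x ^ 2) := fun x => by
    rw [hGn]; simp [mul_comm]
  have hre : ∀ x : ℝ, ‖H x‖ ≤ ∫ t : ℝ, ‖B t‖ * Real.exp (κ * t ^ 2) :=
    norm_le_integral_of_hasDerivAt (h := fun x : ℝ => H x) (h' := fun x : ℝ => G x)
      (fun x => (hH x).comp_ofReal) (hGd.continuous.comp Complex.continuous_ofReal)
      hint (fun x => (hGr x).le) (by simpa using hH0)
  set M := ∫ t : ℝ, ‖B t‖ * Real.exp (κ * t ^ 2)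
  have hgr : ∀ z, ‖H z‖ ≤ C * Real.exp (κ * z.re ^ 2) * ‖z‖ := by
    intro z
    refine norm_le_of_norm_deriv_le hH hH0 fun t ht => (hGb _).trans ?_
    rw [Complex.re_ofReal_mul, mul_pow]
    gcongr
    exact mul_le_of_le_one_left (sq_nonneg _) (pow_le_one₀ ht.1 ht.2)
  have hlin : ∀ z, ‖H z‖ ≤ max M C * (1 + ‖z‖) := by
    intro z
    rcases le_total 0 z.re with h | h
    · exact norm_le_on_right_half_plane hHd hκ hC hgr hre h
    · have := norm_le_on_right_half_plane (H := fun z => H (-z)) (M := M)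
        (hHd.comp differentiable_neg) hκ hC (fun z => by simpa using hgr (-z))
        (fun x => by simpa using hre (-x)) (z := -z) (by simpa using h)
      simpa using this
  have hGbd : ∀ z, ‖G z‖ ≤ max M C := by
    intro z
    -- Cauchy's estimate on circles of radius `R → ∞`: the derivative of a function of linear growth
    -- is bounded.
    have hlim : Filter.Tendsto (fun R : ℝ => max M C * (1 + ‖z‖ + R) / R) Filter.atTop
        (nhds (max M C)) := by
      have h1 : Filter.Tendsto (fun R : ℝ => max M C * (1 + ‖z‖) / R + max M C) Filter.atTop
          (nhds (0 + max M C)) :=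
        (tendsto_const_nhds.div_atTop Filter.tendsto_id).add_const _
      rw [zero_add] at h1
      refine h1.congr' ?_
      filter_upwards [Filter.eventually_gt_atTop 0] with R hR
      field_simp
    refine ge_of_tendsto hlim ?_
    filter_upwards [Filter.eventually_gt_atTop 0] with R hR
    rw [← (hH z).deriv]
    refine Complex.norm_deriv_le_of_forall_mem_sphere_norm_le hR hHd.diffContOnCl fun y hy => ?_
    refine (hlin y).trans ?_
    have hM : 0 ≤ max M C := hC.trans (le_max_right _ _)
    have : ‖y‖ ≤ ‖z‖ + R := by
      have h1 : ‖y - z‖ = R := by simpa [dist_eq_norm] using hy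
      have h2 := norm_add_le (y - z) z
      rw [sub_add_cancel] at h2; linarith
    rw [add_assoc]
    gcongr
  have hconst : ∀ w, G w = G z := fun w => hGd.apply_eq_apply_of_bounded
    (Metric.isBounded_closedBall (x := (0:ℂ)) (r := max M C) |>.subset
      (by rintro _ ⟨w, rfl⟩; simpa using hGbd w)) _ _
  have hi : Integrable (fun _ : ℝ => ‖G z‖) := by
    refine hint.congr (Filter.Eventually.of_forall fun x => ?_)
    simp only [← hGr, hconst]
  rw [integrable_const_iff] at hi
  have hG0 : G z = 0 := by
    rcases hi with h | h
    · simpa using h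
    · exact absurd h.measure_univ_lt_top (by simp)
  exact (mul_eq_zero.mp hG0).resolve_left (Complex.exp_ne_zero _)

theorem eq_zero_of_growth_le_two {B : ℂ → ℂ} (hB : Differentiable ℂ B) {q κ C : ℝ} (hq1 : 1 ≤ q)
    (hq2 : q ≤ 2) (hκ : 0 ≤ κ) (hbd : ∀ z, ‖B z‖ ≤ C * Real.exp (κ * |z.im| ^ q))
    (hint : Integrable fun x : ℝ => ‖B x‖ * Real.exp (κ * |x| ^ q)) (z : ℂ) : B z = 0 := by
  rcases hq2.lt_or_eq with h | rfl
  · exact eq_zero_of_growth_lt_two hB hq1 h hκ hbd hint z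
  · simp only [Real.rpow_ofNat, sq_abs] at hbd hint
    exact eq_zero_of_gaussian_growth hB hκ hbd hint z

/-! ### Characters and Fourier inversion almost everywhere. -/

/-- The character `r ↦ exp(2πir)` of the real line. -/
noncomputable def chr (r : ℝ) : ℂ := Complex.exp (2 * Real.pi * Complex.I * r)

theorem chr_add (r s : ℝ) : chr (r + s) = chr r * chr s := by
  simp only [chr, ← Complex.exp_add]; push_cast; ring_nf

@[simp] theorem norm_chr (r : ℝ) : ‖chr r‖ = 1 := by
  rw [chr, show 2 * Real.pi * Complex.I * (r:ℂ) = ((2 * Real.pi * r : ℝ) : ℂ) * Complex.I by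
    push_cast; ring, Complex.norm_exp_ofReal_mul_I]

@[fun_prop] theorem continuous_chr : Continuous chr := by unfold chr; fun_prop

@[fun_prop] theorem continuous_dotProduct {X ι : Type*} [TopologicalSpace X] [Fintype ι]
    {a b : X → ι → ℝ} (ha : Continuous a) (hb : Continuous b) : Continuous fun x => a x ⬝ᵥ b x := by
  unfold dotProduct; fun_prop

theorem integrable_mul_chr {X : Type*} [MeasurableSpace X] {μ : Measure X} {f : X → ℂ}
    (hf : Integrable f μ) {r : X → ℝ} (hr : AEStronglyMeasurable (fun x => chr (r x)) μ) :
    Integrable (fun x => f x * chr (r x)) μ :=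
  hf.mul_bdd (c := 1) hr (Filter.Eventually.of_forall fun x => by simp)

section inversion
open FourierTransform
open scoped SchwartzMap ContDiff

variable {V : Type*} [NormedAddCommGroup V] [InnerProductSpace ℝ V] [FiniteDimensional ℝ V]
  [MeasurableSpace V] [BorelSpace V]

theorem integral_fourier_mul_eq_flip {f g : V → ℂ} (hf : Integrable f) (hg : Integrable g) :
    ∫ ξ, 𝓕 f ξ * g ξ = ∫ x, f x * 𝓕 g x := by
  have := VectorFourier.integral_fourierIntegral_smul_eq_flip (L := innerₗ V) (μ := volume)
    (ν := volume) (f := f) (g := g) Real.continuous_fourierChar continuous_inner hf hg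
  simpa using! this

theorem integral_fourierInv_mul_eq_flip {f g : V → ℂ} (hf : Integrable f) (hg : Integrable g) :
    ∫ ξ, 𝓕⁻ f ξ * g ξ = ∫ x, f x * 𝓕⁻ g x := by
  rw [Real.fourierInv_eq_fourier_comp_neg g, ← integral_fourier_mul_eq_flip hf hg.comp_neg,
    ← integral_neg_eq_self]
  simp only [Real.fourierInv_eq_fourier_neg, neg_neg]

/-- Fourier inversion almost everywhere for integrable functions with integrable transform. -/
theorem ae_eq_fourierInv_fourier {f : V → ℂ} (hf : Integrable f) (hf' : Integrable (𝓕 f)) :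
    f =ᵐ[volume] 𝓕⁻ (𝓕 f) := by
  have hcont : Continuous (𝓕⁻ (𝓕 f)) := by
    have : Continuous (𝓕 (𝓕 f)) := VectorFourier.fourierIntegral_continuous
      Real.continuous_fourierChar (by exact continuous_inner) hf'
    have e : 𝓕⁻ (𝓕 f) = fun x => 𝓕 (𝓕 f) (-x) := funext fun x => Real.fourierInv_eq_fourier_neg _ _
    rw [e]; exact this.comp continuous_neg
  -- Both sides are tested against smooth compactly supported functions; the transforms move onto
  -- the test function, where Schwartz inversion applies.
  refine ae_eq_of_integral_contDiff_smul_eq hf.locallyIntegrable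
    hcont.locallyIntegrable fun g hg hgc => ?_
  have hg₁ : HasCompactSupport (Complex.ofRealCLM ∘ g) := hgc.comp_left rfl
  have hg₂ : ContDiff ℝ ∞ (Complex.ofRealCLM ∘ g) := by fun_prop
  set φ : 𝓢(V, ℂ) := hg₁.toSchwartzMap hg₂ with hφ
  have hφg : ∀ x, φ x = (g x : ℂ) := fun x => rfl
  have h1 : ∫ x, 𝓕 f x * (𝓕⁻ φ) x = ∫ x, f x * φ x := by
    rw [integral_fourier_mul_eq_flip hf (𝓕⁻ φ).integrable, ← SchwartzMap.fourier_coe,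
      FourierTransform.fourier_fourierInv_eq]
  have h2 : ∫ x, 𝓕⁻ (𝓕 f) x * φ x = ∫ x, 𝓕 f x * (𝓕⁻ φ) x := by
    rw [integral_fourierInv_mul_eq_flip hf' φ.integrable, ← SchwartzMap.fourierInv_coe]
  calc ∫ x, g x • f x = ∫ x, f x * φ x := by simp [hφg, mul_comm]
    _ = ∫ x, 𝓕⁻ (𝓕 f) x * φ x := by rw [h2, h1]
    _ = ∫ x, g x • 𝓕⁻ (𝓕 f) x := by simp [hφg, mul_comm]

end inversion

section pi
open FourierTransform

variable {ι : Type*} [Fintype ι]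

theorem fourier_comp_ofLp (h : (ι → ℝ) → ℂ) (y : EuclideanSpace ℝ ι) :
    𝓕 (fun x : EuclideanSpace ℝ ι => h x.ofLp) y = ∫ x, h x * chr (-(x ⬝ᵥ y.ofLp)) := by
  rw [Real.fourier_eq', ← (PiLp.volume_preserving_ofLp ι).integral_comp
    (MeasurableEquiv.toLp 2 (ι → ℝ)).symm.measurableEmbedding]
  congr 1 with x
  rw [smul_eq_mul, mul_comm, chr]
  congr 2
  rw [EuclideanSpace.inner_eq_star_dotProduct]
  simp [dotProduct_comm]
  ring

theorem fourierInv_comp_ofLp (h : (ι → ℝ) → ℂ) (y : EuclideanSpace ℝ ι) :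
    𝓕⁻ (fun x : EuclideanSpace ℝ ι => h x.ofLp) y = ∫ x, h x * chr (x ⬝ᵥ y.ofLp) := by
  rw [Real.fourierInv_eq_fourier_neg, fourier_comp_ofLp]
  simp

theorem ae_eq_integral_chr_of_neg {h : (ι → ℝ) → ℂ} (hh : Integrable h)
    (hi : Integrable fun y => ∫ x, h x * chr (-(x ⬝ᵥ y))) :
    ∀ᵐ t, h t = ∫ y, (∫ x, h x * chr (-(x ⬝ᵥ y))) * chr (y ⬝ᵥ t) := by
  have hp := PiLp.volume_preserving_ofLp ι
  have he := (MeasurableEquiv.toLp 2 (ι → ℝ)).symm.measurableEmbedding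
  have h1 : Integrable (fun x : EuclideanSpace ℝ ι => h x.ofLp) := hp.integrable_comp_of_integrable hh
  have e : 𝓕 (fun x : EuclideanSpace ℝ ι => h x.ofLp) =
      fun y => (fun y => ∫ x, h x * chr (-(x ⬝ᵥ y))) y.ofLp := funext (fourier_comp_ofLp h)
  have h2 : Integrable (𝓕 (fun x : EuclideanSpace ℝ ι => h x.ofLp)) := by
    rw [e]; exact hp.integrable_comp_of_integrable hi
  have h3 := ae_eq_fourierInv_fourier h1 h2
  rw [e] at h3
  have h4 := (PiLp.volume_preserving_toLp ι).quasiMeasurePreserving.ae h3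
  filter_upwards [h4] with t ht
  exact ht.trans (fourierInv_comp_ofLp (fun y => ∫ x, h x * chr (-(x ⬝ᵥ y))) _)

theorem ae_eq_integral_chr_of_pos {h : (ι → ℝ) → ℂ} (hh : Integrable h)
    (hi : Integrable fun y => ∫ x, h x * chr (x ⬝ᵥ y)) :
    ∀ᵐ t, h t = ∫ y, (∫ x, h x * chr (x ⬝ᵥ y)) * chr (-(y ⬝ᵥ t)) := by
  have e : ∀ y, ∫ x, h (-x) * chr (-(x ⬝ᵥ y)) = ∫ x, h x * chr (x ⬝ᵥ y) := fun y => by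
    rw [← integral_neg_eq_self]; simp
  have h1 := ae_eq_integral_chr_of_neg (h := fun x => h (-x)) hh.comp_neg (by simpa only [e] using hi)
  have h2 := (Measure.measurePreserving_neg (volume : Measure (ι → ℝ))).quasiMeasurePreserving.ae h1
  filter_upwards [h2] with t ht
  simpa only [e, neg_neg, dotProduct_neg] using ht

end pi

/-! ### The Gelfand–Shilov uncertainty principle. -/

/-- The Gelfand–Shilov weight `exp((2π/p) aᵖ|t|ᵖ)`. -/
noncomputable def gsWeight (p a t : ℝ) : ℝ := Real.exp (2 * Real.pi / p * a ^ p * |t| ^ p)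

theorem gsWeight_pos (p a t : ℝ) : 0 < gsWeight p a t := Real.exp_pos _

theorem one_le_gsWeight {p a : ℝ} (hp : 0 < p) (ha : 0 < a) (t : ℝ) : 1 ≤ gsWeight p a t := by
  have := Real.pi_pos
  exact Real.one_le_exp (by positivity)

@[fun_prop] theorem measurable_gsWeight (p a : ℝ) : Measurable (gsWeight p a) := by
  unfold gsWeight; fun_prop

/-- Young's inequality for the product `(a|x|)(r/a)`. It is the source of the dual exponent in the
growth of the transform. -/
theorem exp_mul_le_gsWeight_mul {p q a : ℝ} (hpq : p.HolderConjugate q) (ha : 0 < a) (x : ℝ) {r : ℝ}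
    (hr : 0 ≤ r) :
    Real.exp (2 * Real.pi * |x| * r) ≤ gsWeight p a x * Real.exp (2 * Real.pi / q * (r / a) ^ q) := by
  rw [gsWeight, ← Real.exp_add]
  apply Real.exp_le_exp.mpr
  have h := Real.young_inequality_of_nonneg (a := a * |x|) (b := r / a) (by positivity)
    (by positivity) hpq
  rw [Real.mul_rpow ha.le (abs_nonneg x)] at h
  have e : a * |x| * (r / a) = |x| * r := by field_simp
  rw [e] at h
  have := mul_le_mul_of_nonneg_left h (by positivity : 0 ≤ 2 * Real.pi)
  calc _ = 2 * Real.pi * (|x| * r) := by ring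
    _ ≤ _ := this
    _ = _ := by ring

section entire
variable {p q a s : ℝ} {f : ℝ → ℂ}

theorem norm_exp_kernel (hs : s = 1 ∨ s = -1) (x : ℝ) (z : ℂ) :
    ‖Complex.exp (2 * Real.pi * Complex.I * s * x * z)‖ ≤
      Real.exp (2 * Real.pi * |x| * |z.im|) := by
  rw [Complex.norm_exp]
  apply Real.exp_le_exp.mpr
  have e : 2 * Real.pi * Complex.I * s * x * z = ((2 * Real.pi * s * x : ℝ) : ℂ) * (Complex.I * z) := by
    push_cast; ring
  rw [e, Complex.re_ofReal_mul, Complex.I_mul_re]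
  calc _ ≤ |2 * Real.pi * s * x * -z.im| := le_abs_self _
    _ = _ := by
      rw [abs_mul, abs_mul, abs_mul, abs_neg, abs_of_pos Real.two_pi_pos]
      rcases hs with rfl | rfl <;> simp

theorem integrable_kernel (hpq : p.HolderConjugate q) (ha : 0 < a) (hs : s = 1 ∨ s = -1)
    (hf : Integrable fun x => gsWeight p a x • f x) (z : ℂ) :
    Integrable (fun x : ℝ => f x * Complex.exp (2 * Real.pi * Complex.I * s * x * z)) ∧
    ‖∫ x : ℝ, f x * Complex.exp (2 * Real.pi * Complex.I * s * x * z)‖ ≤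
      (∫ x, ‖gsWeight p a x • f x‖) * Real.exp (2 * Real.pi / q * (|z.im| / a) ^ q) := by
  have hb : ∀ x, ‖f x * Complex.exp (2 * Real.pi * Complex.I * s * x * z)‖ ≤
      ‖gsWeight p a x • f x‖ * Real.exp (2 * Real.pi / q * (|z.im| / a) ^ q) := by
    intro x
    rw [norm_mul, norm_smul, Real.norm_of_nonneg (gsWeight_pos _ _ _).le, mul_comm (gsWeight _ _ _),
      mul_assoc ‖f x‖]
    gcongr
    exact (norm_exp_kernel hs x z).trans (exp_mul_le_gsWeight_mul hpq ha x (abs_nonneg _))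
  have hfm : AEStronglyMeasurable f volume := by
    have : f = fun x => (gsWeight p a x)⁻¹ • (gsWeight p a x • f x) := by
      ext x; rw [smul_smul, inv_mul_cancel₀ (gsWeight_pos _ _ _).ne', one_smul]
    rw [this]
    exact (measurable_gsWeight p a).inv.aestronglyMeasurable.smul hf.1
  have hi := hf.norm.mul_const (Real.exp (2 * Real.pi / q * (|z.im| / a) ^ q))
  refine ⟨hi.mono' (hfm.mul (by fun_prop)) (Filter.Eventually.of_forall hb), ?_⟩
  rw [← integral_mul_const]
  exact norm_integral_le_of_norm_le hi (Filter.Eventually.of_forall hb)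

theorem differentiable_integral_kernel (hpq : p.HolderConjugate q) (ha : 0 < a)
    (hs : s = 1 ∨ s = -1) (hf : Integrable fun x => gsWeight p a x • f x) :
    Differentiable ℂ fun z => ∫ x : ℝ, f x * Complex.exp (2 * Real.pi * Complex.I * s * x * z) := by
  intro z₀
  set R : ℝ := ‖z₀‖ + 1 with hR
  have key := hasDerivAt_integral_of_dominated_loc_of_deriv_le (μ := volume)
    (F := fun z (x : ℝ) => f x * Complex.exp (2 * Real.pi * Complex.I * s * x * z))
    (F' := fun z (x : ℝ) => f x * (Complex.exp (2 * Real.pi * Complex.I * s * x * z) *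
      (2 * Real.pi * Complex.I * s * x)))
    (x₀ := z₀) (s := Metric.ball z₀ 1)
    -- On the unit ball `|Im z| ≤ R`; the extra `1` absorbs the factor `2π|x|` from differentiating,
    -- via `2π|x| ≤ exp(2π|x|)`.
    (bound := fun x => ‖gsWeight p a x • f x‖ * Real.exp (2 * Real.pi / q * ((R + 1) / a) ^ q))
    (Metric.ball_mem_nhds _ one_pos)
    (Filter.Eventually.of_forall fun z => (integrable_kernel hpq ha hs hf z).1.1)
    (integrable_kernel hpq ha hs hf z₀).1
    ?_ ?_ (hf.norm.mul_const _) ?_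
  · exact key.2.differentiableAt
  · have h1 := (integrable_kernel hpq ha hs hf z₀).1.1
    have h2 : AEStronglyMeasurable (fun x : ℝ => 2 * Real.pi * Complex.I * s * (x:ℂ)) volume := by
      fun_prop
    refine (h1.mul h2).congr (Filter.Eventually.of_forall fun x => ?_)
    simp only [Pi.mul_apply]; ring
  · refine Filter.Eventually.of_forall fun x z hz => ?_
    have hzR : |z.im| ≤ R := by
      have h1 : ‖z - z₀‖ < 1 := by simpa [dist_eq_norm] using hz
      have h2 := norm_add_le (z - z₀) z₀
      rw [sub_add_cancel] at h2
      linarith [Complex.abs_im_le_norm z]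
    rw [norm_mul, norm_mul, norm_smul, Real.norm_of_nonneg (gsWeight_pos _ _ _).le,
      mul_comm (gsWeight _ _ _), mul_assoc ‖f x‖]
    refine mul_le_mul_of_nonneg_left ?_ (norm_nonneg _)
    have hs1 : |s| = 1 := by rcases hs with rfl | rfl <;> simp
    have h3 : ‖(2 * Real.pi * Complex.I * s * x : ℂ)‖ = 2 * Real.pi * |x| := by
      simp [hs1, abs_of_pos Real.pi_pos]
    have h0 : 0 ≤ 2 * Real.pi * |x| := by positivity
    rw [h3]
    calc _ ≤ Real.exp (2 * Real.pi * |x| * R) * Real.exp (2 * Real.pi * |x|) := by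
          gcongr
          · exact (norm_exp_kernel hs x z).trans (by gcongr)
          · linarith [Real.add_one_le_exp (2 * Real.pi * |x|)]
      _ = Real.exp (2 * Real.pi * |x| * (R + 1)) := by rw [← Real.exp_add]; ring_nf
      _ ≤ _ := exp_mul_le_gsWeight_mul hpq ha x (by positivity)
  · refine Filter.Eventually.of_forall fun x z _ => ?_
    refine HasDerivAt.const_mul _ (HasDerivAt.cexp ?_)
    simpa using (hasDerivAt_id z).const_mul (2 * Real.pi * Complex.I * s * x : ℂ)

/-- Gelfand–Shilov uncertainty principle on the line, when the transform has order at most two. -/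
theorem gelfandShilov_real (hpq : p.HolderConjugate q) (hq2 : q ≤ 2) {b : ℝ} (ha : 0 < a)
    (hb : 0 < b) (hab : 1 ≤ a * b) (hs : s = 1 ∨ s = -1)
    (hf : Integrable fun x => gsWeight p a x • f x)
    (hf' : Integrable fun y => gsWeight q b y • ∫ x, f x * chr (s * (x * y))) (y : ℝ) :
    ∫ x, f x * chr (s * (x * y)) = 0 := by
  have e : ∀ y : ℝ, ∫ x : ℝ, f x * Complex.exp (2 * Real.pi * Complex.I * s * x * (y:ℂ)) =
      ∫ x, f x * chr (s * (x * y)) := by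
    intro y
    congr 1 with x
    rw [chr]; push_cast; ring_nf
  have hq0 := hpq.symm.pos
  rw [← e]
  refine eq_zero_of_growth_le_two (differentiable_integral_kernel hpq ha hs hf) (q := q)
    (κ := 2 * Real.pi / q * b ^ q) (C := ∫ x, ‖gsWeight p a x • f x‖) hpq.symm.lt.le hq2
    (by positivity) (fun z => ?_) ?_ y
  · refine (integrable_kernel hpq ha hs hf z).2.trans ?_
    -- Here `1 ≤ a * b` enters: `|Im z| / a ≤ b |Im z|`, so the growth constant is at most the decay
    -- constant.
    rw [mul_assoc _ (b ^ q), ← Real.mul_rpow hb.le (abs_nonneg _)]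
    gcongr
    rw [div_le_iff₀ ha]
    nlinarith [abs_nonneg z.im]
  · refine hf'.norm.congr (Filter.Eventually.of_forall fun y => ?_)
    simp only [e]
    rw [norm_smul, gsWeight, Real.norm_of_nonneg (Real.exp_pos _).le, mul_comm]

end entire

/-- Gelfand–Shilov uncertainty principle with decay in one coordinate only. -/
theorem gelfandShilov_pi {m : ℕ} {p q a b s : ℝ} (hpq : p.HolderConjugate q) (hq2 : q ≤ 2)
    (ha : 0 < a) (hb : 0 < b) (hab : 1 ≤ a * b) (hs : s = 1 ∨ s = -1)
    {f : (Fin (m + 1) → ℝ) → ℂ} (hf : Integrable fun x => gsWeight p a (x 0) • f x)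
    (hf' : Integrable fun y => gsWeight q b (y 0) • ∫ x, f x * chr (s * (x ⬝ᵥ y))) :
    ∀ᵐ y, ∫ x, f x * chr (s * (x ⬝ᵥ y)) = 0 := by
  set E := (MeasurableEquiv.piFinSuccAbove (fun _ : Fin (m + 1) => ℝ) 0).symm with hE
  have hEp : MeasurePreserving E volume volume :=
    (volume_preserving_piFinSuccAbove (fun _ : Fin (m + 1) => ℝ) 0).symm
  have hE0 : ∀ z, E z 0 = z.1 := fun z => by simp [hE, MeasurableEquiv.piFinSuccAbove]
  have hEdot : ∀ z w, E z ⬝ᵥ E w = z.1 * w.1 + z.2 ⬝ᵥ w.2 := fun z w => by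
    simp [hE, MeasurableEquiv.piFinSuccAbove, dotProduct, Fin.sum_univ_succ]
  have hfE : Integrable (fun z : ℝ × (Fin m → ℝ) => gsWeight p a z.1 • f (E z)) := by
    have := hEp.integrable_comp_of_integrable hf
    simpa only [Function.comp_def, hE0] using this
  have hfE1 : Integrable (fun z : ℝ × (Fin m → ℝ) => f (E z)) := by
    have e : (fun z : ℝ × (Fin m → ℝ) => f (E z)) =
        fun z => (gsWeight p a z.1)⁻¹ • (gsWeight p a z.1 • f (E z)) := by
      ext z; rw [smul_smul, inv_mul_cancel₀ (gsWeight_pos _ _ _).ne', one_smul]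
    have hm : AEStronglyMeasurable (fun z : ℝ × (Fin m → ℝ) => f (E z)) := by
      rw [e]
      exact ((measurable_gsWeight p a).comp measurable_fst).inv.aestronglyMeasurable.smul hfE.1
    refine hfE.mono hm (Filter.Eventually.of_forall fun z => ?_)
    rw [norm_smul, Real.norm_of_nonneg (gsWeight_pos _ _ _).le]
    exact le_mul_of_one_le_left (norm_nonneg _) (one_le_gsWeight hpq.pos ha _)
  -- Transforming in all but coordinate `0` leaves a one-dimensional problem for almost every
  -- frequency `y'`.
  set ψ : (Fin m → ℝ) → ℝ → ℂ := fun y' x₀ => ∫ x', f (E (x₀, x')) * chr (s * (x' ⬝ᵥ y')) with hψ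
  have hft : ∀ y : ℝ × (Fin m → ℝ), ∫ x, f x * chr (s * (x ⬝ᵥ E y)) =
      ∫ x₀, ψ y.2 x₀ * chr (s * (x₀ * y.1)) := by
    intro y
    rw [← hEp.integral_comp E.measurableEmbedding]
    simp only [hEdot]
    rw [Measure.volume_eq_prod, integral_prod]
    · congr 1 with x₀
      rw [hψ, ← integral_mul_const]
      congr 1 with x'
      rw [mul_add, chr_add]; ring
    · exact integrable_mul_chr hfE1 (Continuous.aestronglyMeasurable (by fun_prop))
  have hψi : ∀ y', Integrable fun x₀ => gsWeight p a x₀ • ψ y' x₀ := by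
    intro y'
    have h1 : Integrable (fun z : ℝ × (Fin m → ℝ) =>
        (gsWeight p a z.1 • f (E z)) * chr (s * (z.2 ⬝ᵥ y'))) :=
      integrable_mul_chr hfE (Continuous.aestronglyMeasurable (by fun_prop))
    rw [Measure.volume_eq_prod] at h1
    refine h1.integral_prod_left.congr (Filter.Eventually.of_forall fun x₀ => ?_)
    simp only [hψ, smul_mul_assoc]
    exact integral_smul _ _
  have h2 : Integrable (fun y : ℝ × (Fin m → ℝ) =>
      gsWeight q b y.1 • ∫ x₀, ψ y.2 x₀ * chr (s * (x₀ * y.1))) := by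
    have := hEp.integrable_comp_of_integrable hf'
    simpa only [Function.comp_def, hE0, hft] using this
  rw [Measure.volume_eq_prod] at h2
  have h3 := h2.prod_left_ae
  have h4 : ∀ᵐ y' : Fin m → ℝ, ∀ y₀, ∫ x₀, ψ y' x₀ * chr (s * (x₀ * y₀)) = 0 := by
    filter_upwards [h3] with y' hy' y₀
    exact gelfandShilov_real hpq hq2 ha hb hab hs (hψi y') hy' y₀
  have h5 : ∀ᵐ y : ℝ × (Fin m → ℝ), ∫ x, f x * chr (s * (x ⬝ᵥ E y)) = 0 := by
    have := (Measure.quasiMeasurePreserving_snd (μ := (volume : Measure ℝ))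
      (ν := (volume : Measure (Fin m → ℝ)))).ae h4
    rw [Measure.volume_eq_prod]
    filter_upwards [this] with y hy
    rw [hft]; exact hy _
  have h6 := hEp.symm.quasiMeasurePreserving.ae h5
  filter_upwards [h6] with y hy
  simpa using hy

/-! ### Convolution integrals and the short-time Fourier transform. -/

section convolution
variable {G : Type*} [AddCommGroup G] [MeasurableSpace G] [MeasurableAdd₂ G] [MeasurableNeg G]
  {μ : Measure G} [SFinite μ] [μ.IsAddLeftInvariant] {N M : G → ENNReal}

theorem lintegral_lintegral_mul_sub (hN : Measurable N) (hM : Measurable M) :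
    ∫⁻ c, ∫⁻ z, N z * M (c - z) ∂μ ∂μ = (∫⁻ z, N z ∂μ) * ∫⁻ z, M z ∂μ := by
  rw [lintegral_lintegral_swap (by fun_prop)]
  rw [← lintegral_mul_const _ hN]
  congr 1 with z
  rw [lintegral_const_mul _ (by fun_prop), lintegral_sub_right_eq_self M z]

theorem lintegral_lintegral_mul_sub' [μ.IsNegInvariant] (hN : Measurable N) (hM : Measurable M) :
    ∫⁻ c, ∫⁻ z, N z * M (z - c) ∂μ ∂μ = (∫⁻ z, N z ∂μ) * ∫⁻ z, M z ∂μ := by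
  rw [lintegral_lintegral_swap (by fun_prop)]
  rw [← lintegral_mul_const _ hN]
  congr 1 with z
  rw [lintegral_const_mul _ (by fun_prop), lintegral_sub_left_eq_self M z]

end convolution

section stft
variable {ι : Type*} [Fintype ι]

/-- The short-time Fourier transform of `f` with window `g`. -/
noncomputable def stft (f g : (ι → ℝ) → ℂ) (x ω : ι → ℝ) : ℂ :=
  ∫ t, f t * starRingEnd ℂ (g (t - x)) * chr (-(t ⬝ᵥ ω))

theorem measurable_stft {f g : (ι → ℝ) → ℂ} (hf : Measurable f) (hg : Measurable g) :
    Measurable fun z : (ι → ℝ) × (ι → ℝ) => stft f g z.1 z.2 := by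
  have h1 : Measurable fun y : ((ι → ℝ) × (ι → ℝ)) × (ι → ℝ) =>
      f y.2 * starRingEnd ℂ (g (y.2 - y.1.1)) * chr (-(y.2 ⬝ᵥ y.1.2)) := by
    refine ((hf.comp measurable_snd).mul
      (Complex.continuous_conj.measurable.comp (hg.comp (by fun_prop)))).mul ?_
    exact (by fun_prop : Continuous fun y : ((ι → ℝ) × (ι → ℝ)) × (ι → ℝ) =>
      chr (-(y.2 ⬝ᵥ y.1.2))).measurable
  exact h1.stronglyMeasurable.integral_prod_right.measurable

theorem integrable_mul_conj_comp_sub {f g : (ι → ℝ) → ℂ} (hf : MemLp f 2) (hg : MemLp g 2)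
    (x : ι → ℝ) : Integrable fun t => f t * starRingEnd ℂ (g (t - x)) := by
  have h1 : MemLp (fun t => g (t - x)) 2 :=
    hg.comp_measurePreserving (measurePreserving_sub_right volume x)
  exact hf.integrable_mul h1.star

/-- The Fourier transform of a reflected product of Fourier transforms. -/
theorem integral_transform_mul_transform {h₁ h₂ : (ι → ℝ) → ℂ} (hh₁ : Integrable h₁)
    (hh₂ : Integrable h₂) (hi : Integrable fun ω => ∫ t, h₂ t * chr (-(t ⬝ᵥ ω))) (ω₀ v : ι → ℝ) :
    ∫ ω, (∫ t, h₁ t * chr (-(t ⬝ᵥ (ω₀ + ω)))) * (∫ t, h₂ t * chr (-(t ⬝ᵥ (ω₀ - ω)))) *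
        chr (ω ⬝ᵥ v) =
      ∫ t, h₁ t * h₂ (t - v) * chr (-((t + (t - v)) ⬝ᵥ ω₀)) := by
  set H := fun ω => ∫ t, h₂ t * chr (-(t ⬝ᵥ ω)) with hH
  have hswap : Integrable (fun z : (ι → ℝ) × (ι → ℝ) => (H (ω₀ - z.1) * h₁ z.2) *
      chr (-(z.2 ⬝ᵥ (ω₀ + z.1)) + z.1 ⬝ᵥ v)) :=
    integrable_mul_chr ((hi.comp_sub_left ω₀).mul_prod hh₁)
      (Continuous.aestronglyMeasurable (by fun_prop))
  calc _ = ∫ ω, ∫ t, (H (ω₀ - ω) * h₁ t) * chr (-(t ⬝ᵥ (ω₀ + ω)) + ω ⬝ᵥ v) := by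
        congr 1 with ω
        rw [mul_right_comm, ← integral_mul_const, ← integral_mul_const]
        congr 1 with t
        rw [chr_add]; ring
    _ = ∫ t, ∫ ω, (H (ω₀ - ω) * h₁ t) * chr (-(t ⬝ᵥ (ω₀ + ω)) + ω ⬝ᵥ v) :=
        integral_integral_swap hswap
    _ = _ := by
        -- Inversion is needed for `h₂` only: after `ω ↦ ω₀ - ω` the inner integral reproduces `h₂
        -- (t - v)`.
        have hinv := (measurePreserving_sub_right volume v).quasiMeasurePreserving.ae
          (ae_eq_integral_chr_of_neg hh₂ hi)
        refine integral_congr_ae ?_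
        filter_upwards [hinv] with t ht
        rw [ht, ← integral_sub_left_eq_self _ volume ω₀, mul_right_comm, ← integral_const_mul]
        congr 1 with ω
        rw [show ω₀ - (ω₀ - ω) = ω by abel,
          show -(t ⬝ᵥ (ω₀ + (ω₀ - ω))) + (ω₀ - ω) ⬝ᵥ v =
            -((t + (t - v)) ⬝ᵥ ω₀) + ω ⬝ᵥ (t - v) by
          simp only [dotProduct_add, add_dotProduct, dotProduct_sub, sub_dotProduct,
            dotProduct_comm ω t, dotProduct_comm v ω₀]
          ring, chr_add]
        ring

/-- The chirped reflected product of the short-time Fourier transform with itself, whose partial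
Fourier transform is a symmetric kernel. -/
noncomputable def reflectedProduct (f g : (ι → ℝ) → ℂ) (w : (ι → ℝ) × (ι → ℝ)) (x ω : ι → ℝ) : ℂ :=
  stft f g (w.1 + x) (w.2 + ω) * stft f g (w.1 - x) (w.2 - ω) * chr (ω ⬝ᵥ x)

theorem integral_reflectedProduct {f g : (ι → ℝ) → ℂ} (hf : MemLp f 2) (hg : MemLp g 2)
    (w : (ι → ℝ) × (ι → ℝ)) {x : ι → ℝ} (hx : Integrable (stft f g (w.1 - x))) (u : ι → ℝ) :
    ∫ ω, reflectedProduct f g w x ω * chr (ω ⬝ᵥ u) =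
      ∫ t, f t * f (t - (x + u)) * (starRingEnd ℂ (g (t - w.1 - x)) *
        starRingEnd ℂ (g (t - w.1 - u))) * chr (-((t + (t - (x + u))) ⬝ᵥ w.2)) := by
  have := integral_transform_mul_transform (integrable_mul_conj_comp_sub hf hg (w.1 + x))
    (integrable_mul_conj_comp_sub hf hg (w.1 - x)) hx w.2 (x + u)
  calc _ = _ := by
        congr 1 with ω
        rw [reflectedProduct, mul_assoc, ← chr_add, ← dotProduct_add]
        rfl
    _ = _ := this
    _ = _ := by
        congr 1 with t
        rw [show t - (w.1 + x) = t - w.1 - x by abel,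
          show t - (x + u) - (w.1 - x) = t - w.1 - u by abel]
        ring

/-- The `f`-factors and the phase depend on `x + u` only, and exchanging `x` with `u` exchanges the
two `g`-factors. The chirp in `reflectedProduct` is what shifts `u` to `x + u`. -/
theorem integral_reflectedProduct_symm {f g : (ι → ℝ) → ℂ} (hf : MemLp f 2) (hg : MemLp g 2)
    (w : (ι → ℝ) × (ι → ℝ)) {x u : ι → ℝ} (hx : Integrable (stft f g (w.1 - x)))
    (hu : Integrable (stft f g (w.1 - u))) :
    ∫ ω, reflectedProduct f g w x ω * chr (ω ⬝ᵥ u) =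
      ∫ ω, reflectedProduct f g w u ω * chr (ω ⬝ᵥ x) := by
  rw [integral_reflectedProduct hf hg w hx, integral_reflectedProduct hf hg w hu, add_comm u x]
  congr 1 with t
  ring

theorem measurable_reflectedProduct {f g : (ι → ℝ) → ℂ} (hf : Measurable f) (hg : Measurable g)
    (w : (ι → ℝ) × (ι → ℝ)) :
    Measurable fun z : (ι → ℝ) × (ι → ℝ) => reflectedProduct f g w z.1 z.2 := by
  have h1 : Measurable fun z : (ι → ℝ) × (ι → ℝ) => (w.1 + z.1, w.2 + z.2) := by fun_prop
  have h2 : Measurable fun z : (ι → ℝ) × (ι → ℝ) => (w.1 - z.1, w.2 - z.2) := by fun_prop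
  have h3 := (measurable_stft hf hg).comp h1
  have h4 := (measurable_stft hf hg).comp h2
  have h5 : Measurable fun z : (ι → ℝ) × (ι → ℝ) => chr (z.2 ⬝ᵥ z.1) :=
    (by fun_prop : Continuous fun z : (ι → ℝ) × (ι → ℝ) => chr (z.2 ⬝ᵥ z.1)).measurable
  exact (h3.mul h4).mul h5

/-- If the short-time Fourier transform vanishes, then so does the signal or the window. -/
theorem ae_eq_zero_or_of_stft {f g : (ι → ℝ) → ℂ} (hf : MemLp f 2) (hg : MemLp g 2)
    (hfm : Measurable f) (hgm : Measurable g)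
    (h : ∀ᵐ z : (ι → ℝ) × (ι → ℝ), stft f g z.1 z.2 = 0) :
    f =ᵐ[volume] 0 ∨ g =ᵐ[volume] 0 := by
  rw [Measure.volume_eq_prod] at h
  have h1 : ∀ᵐ x : ι → ℝ, ∀ᵐ t, f t * starRingEnd ℂ (g (t - x)) = 0 := by
    filter_upwards [Measure.ae_ae_of_ae_prod h] with x hx
    have hx' : (fun ω => ∫ t, f t * starRingEnd ℂ (g (t - x)) * chr (-(t ⬝ᵥ ω))) =ᵐ[volume] 0 := hx
    have hinv := ae_eq_integral_chr_of_neg (integrable_mul_conj_comp_sub hf hg x)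
      ((integrable_congr hx').mpr (integrable_zero _ _ _))
    filter_upwards [hinv] with t ht
    rw [ht]
    refine integral_eq_zero_of_ae ?_
    filter_upwards [hx'] with ω hω
    rw [hω]; simp
  -- By Tonelli this integral is the product of the integrals of `‖f‖ₑ` and `‖g‖ₑ`, possibly
  -- infinite, so one of them is zero.
  have h2 : ∫⁻ x : ι → ℝ, ∫⁻ t, ‖f t‖ₑ * ‖g (t - x)‖ₑ = 0 := by
    rw [← lintegral_zero (μ := (volume : Measure (ι → ℝ)))]
    refine lintegral_congr_ae ?_
    filter_upwards [h1] with x hx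
    rw [← lintegral_zero (μ := (volume : Measure (ι → ℝ)))]
    refine lintegral_congr_ae ?_
    filter_upwards [hx] with t ht
    have : ‖f t * starRingEnd ℂ (g (t - x))‖ₑ = 0 := by rw [ht]; simp
    simpa [enorm_mul] using this
  rw [lintegral_lintegral_mul_sub' (M := fun y => ‖g y‖ₑ) (by fun_prop) (by fun_prop), mul_eq_zero,
    lintegral_eq_zero_iff (by fun_prop), lintegral_eq_zero_iff (by fun_prop)] at h2
  refine h2.imp (fun h => ?_) fun h => ?_ <;>
  · filter_upwards [h] with t ht
    simpa using ht

end stft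

/-! ### Weights at reflected points, and symmetric kernels. -/

/-- The weight `exp((π/p) aᵖ|t|ᵖ)`, a square root of `gsWeight`. -/
noncomputable def stWeight (p a t : ℝ) : ℝ := Real.exp (Real.pi / p * a ^ p * |t| ^ p)

theorem stWeight_pos (p a t : ℝ) : 0 < stWeight p a t := Real.exp_pos _

@[fun_prop] theorem measurable_stWeight (p a : ℝ) : Measurable (stWeight p a) := by
  unfold stWeight; fun_prop

theorem one_le_stWeight {p a : ℝ} (hp : 0 < p) (ha : 0 < a) (t : ℝ) : 1 ≤ stWeight p a t := by
  have := Real.pi_pos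
  exact Real.one_le_exp (by positivity)

theorem two_mul_abs_rpow_le {p : ℝ} (hp : 1 ≤ p) (s t : ℝ) :
    2 * |t| ^ p ≤ |s + t| ^ p + |s - t| ^ p := by
  have h1 : |t| ≤ 1 / 2 * |s + t| + 1 / 2 * |s - t| := by
    have := abs_sub (s + t) (s - t)
    rw [show s + t - (s - t) = 2 * t by ring, abs_mul, abs_two] at this
    linarith
  have h2 := (convexOn_rpow hp).2 (abs_nonneg (s + t)) (abs_nonneg (s - t))
    (by norm_num : (0:ℝ) ≤ 1 / 2) (by norm_num : (0:ℝ) ≤ 1 / 2) (by norm_num)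
  simp only [smul_eq_mul] at h2
  have h3 := Real.rpow_le_rpow (abs_nonneg t) h1 (by linarith : 0 ≤ p)
  linarith

theorem gsWeight_le_stWeight_mul {p a : ℝ} (hp : 1 ≤ p) (ha : 0 < a) (s t : ℝ) :
    gsWeight p a t ≤ stWeight p a (s + t) * stWeight p a (s - t) := by
  rw [gsWeight, stWeight, stWeight, ← Real.exp_add]
  apply Real.exp_le_exp.mpr
  have := mul_le_mul_of_nonneg_left (two_mul_abs_rpow_le hp s t)
    (by have := Real.pi_pos; positivity : 0 ≤ Real.pi / p * a ^ p)
  calc _ = Real.pi / p * a ^ p * (2 * |t| ^ p) := by ring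
    _ ≤ _ := this
    _ = _ := by ring

/-- A function whose partial Fourier transform is a symmetric kernel, and which decays in one
coordinate of each of its two arguments at a Gelfand–Shilov rate, vanishes. -/
theorem ae_eq_zero_of_symmetric_transform {m : ℕ} {p q a b : ℝ} (hpq : p.HolderConjugate q)
    (ha : 0 < a) (hb : 0 < b) (hab : 1 ≤ a * b)
    {F : (Fin (m + 1) → ℝ) → (Fin (m + 1) → ℝ) → ℂ}
    (hF : Measurable fun z : (Fin (m + 1) → ℝ) × (Fin (m + 1) → ℝ) => F z.1 z.2)
    (hsymm : ∀ᵐ u, ∀ᵐ x, ∫ ω, F u ω * chr (ω ⬝ᵥ x) = ∫ ω, F x ω * chr (ω ⬝ᵥ u))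
    (hx : Integrable fun z : (Fin (m + 1) → ℝ) × (Fin (m + 1) → ℝ) =>
      gsWeight p a (z.1 0) • F z.1 z.2)
    (hω : Integrable fun z : (Fin (m + 1) → ℝ) × (Fin (m + 1) → ℝ) =>
      gsWeight q b (z.2 0) • F z.1 z.2) :
    ∀ᵐ z : (Fin (m + 1) → ℝ) × (Fin (m + 1) → ℝ), F z.1 z.2 = 0 := by
  have of_weight : ∀ {r c : ℝ} (_ : 0 < r) (_ : 0 < c) {h : (Fin (m + 1) → ℝ) → ℂ},
      (Integrable fun y => gsWeight r c (y 0) • h y) → Integrable h := by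
    intro r c hr hc h hh
    have e : h = fun y => (gsWeight r c (y 0))⁻¹ • (gsWeight r c (y 0) • h y) := by
      ext y; rw [smul_smul, inv_mul_cancel₀ (gsWeight_pos _ _ _).ne', one_smul]
    have hm : AEStronglyMeasurable h := by
      rw [e]
      exact ((measurable_gsWeight r c).comp (measurable_pi_apply 0)).inv.aestronglyMeasurable.smul
        hh.1
    refine hh.mono hm (Filter.Eventually.of_forall fun z => ?_)
    rw [norm_smul, Real.norm_of_nonneg (gsWeight_pos _ _ _).le]
    exact le_mul_of_one_le_left (norm_nonneg _) (one_le_gsWeight hr hc _)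
  rw [Measure.volume_eq_prod] at hω hx ⊢
  refine (Measure.ae_prod_iff_ae_ae (hF (measurableSet_singleton 0))).mpr ?_
  filter_upwards [hsymm, hω.prod_right_ae] with u hu hωu
  have hFu : Integrable (F u) := of_weight hpq.symm.pos hb hωu
  -- By symmetry the transform of `F u` at `x` is the transform of `F x` at `u`, and so inherits the
  -- decay of `F` in its first argument.
  have hK : Integrable fun x => gsWeight p a (x 0) • ∫ ω, F u ω * chr (1 * (ω ⬝ᵥ x)) := by
    have h1 : Integrable (fun z : (Fin (m + 1) → ℝ) × (Fin (m + 1) → ℝ) =>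
        (gsWeight p a (z.1 0) • F z.1 z.2) * chr (z.2 ⬝ᵥ u)) (volume.prod volume) :=
      integrable_mul_chr hx (Continuous.aestronglyMeasurable (by fun_prop))
    refine h1.integral_prod_left.congr ?_
    filter_upwards [hu] with x hx
    simp only [one_mul, hx, smul_mul_assoc]
    exact integral_smul _ _
  -- Gelfand–Shilov needs the transform side to carry the exponent at most two. If `q ≤ 2` it is
  -- applied to the transform of `F u`, with `F u` recovered by inversion; otherwise `p ≤ 2` and it
  -- is applied to `F u` directly.
  rcases le_total q 2 with h2 | h2
  · have hKi : Integrable fun x => ∫ ω, F u ω * chr (ω ⬝ᵥ x) := by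
      simpa only [one_mul] using of_weight hpq.pos ha hK
    have hinv := ae_eq_integral_chr_of_pos hFu hKi
    have h0 := gelfandShilov_pi (s := -1) hpq h2 ha hb hab (Or.inr rfl)
      (f := fun x => ∫ ω, F u ω * chr (ω ⬝ᵥ x)) (by simpa only [one_mul] using hK) ?_
    · filter_upwards [hinv, h0] with ω h1 h3
      rw [h1]
      simpa using h3
    · refine hωu.congr ?_
      filter_upwards [hinv] with ω h1
      simp only [neg_one_mul]
      rw [← h1]
  · have hp2 : p ≤ 2 := by
      have h3 := hpq.sub_one_mul_conj
      have h4 := hpq.sub_one_pos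
      nlinarith
    have h0 := gelfandShilov_pi (s := 1) hpq.symm hp2 hb ha (by rwa [mul_comm]) (Or.inl rfl) hωu hK
    simp only [one_mul] at h0
    have hinv := ae_eq_integral_chr_of_pos hFu
      ((integrable_congr (show _ =ᵐ[volume] 0 from h0)).mpr (integrable_zero _ _ _))
    filter_upwards [hinv] with ω h1
    rw [h1]
    refine integral_eq_zero_of_ae ?_
    filter_upwards [h0] with x h3
    rw [h3]; simp

/-! ### The uncertainty principle for the short-time Fourier transform. -/

section halves
variable {G : Type*} [AddCommGroup G] [Module ℝ G] [MeasurableSpace G] [MeasurableAdd₂ G]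
  {μ : Measure G} [μ.IsAddLeftInvariant] {N : G → ENNReal}

theorem lintegral_half_add_mul_half_sub (c : G) :
    ∫⁻ z, N ((1 / 2 : ℝ) • c + z) * N ((1 / 2 : ℝ) • c - z) ∂μ = ∫⁻ z, N z * N (c - z) ∂μ := by
  rw [← lintegral_add_left_eq_self (fun z => N z * N (c - z)) ((1 / 2 : ℝ) • c)]
  congr 1 with z
  congr 2
  have : c = (1 / 2 : ℝ) • c + (1 / 2 : ℝ) • c := by rw [← add_smul]; norm_num
  nth_rw 2 [this]; abel

/-- With centre `c / 2` the reflected product integrates to `(N ∗ N)(c)`, and a convolution of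
integrable functions is finite almost everywhere. -/
theorem ae_lintegral_half_add_mul_half_sub_lt_top [MeasurableNeg G] [SFinite μ]
    (hN : Measurable N) (hfin : ∫⁻ z, N z ∂μ < ⊤) :
    ∀ᵐ c ∂μ, ∫⁻ z, N ((1 / 2 : ℝ) • c + z) * N ((1 / 2 : ℝ) • c - z) ∂μ < ⊤ := by
  simp only [lintegral_half_add_mul_half_sub]
  refine ae_lt_top (Measurable.lintegral_prod_right' (f := fun y : G × G => N y.2 * N (y.1 - y.2))
    (by fun_prop)) ?_
  rw [lintegral_lintegral_mul_sub hN hN]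
  exact (ENNReal.mul_lt_top hfin hfin).ne

end halves

/-- The uncertainty principle for the short-time Fourier transform, with weights in the first
coordinates only. -/
theorem stft_uncertainty {m : ℕ} {p q a b : ℝ} (hpq : p.HolderConjugate q)
    (ha : 0 < a) (hb : 0 < b) (hab : 1 ≤ a * b) {f g : (Fin (m + 1) → ℝ) → ℂ}
    (hf : MemLp f 2) (hg : MemLp g 2) (hfm : Measurable f) (hgm : Measurable g)
    (hx : ∫⁻ z : (Fin (m + 1) → ℝ) × (Fin (m + 1) → ℝ),
      ‖stft f g z.1 z.2‖ₑ * ENNReal.ofReal (stWeight p a (z.1 0)) < ⊤)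
    (hω : ∫⁻ z : (Fin (m + 1) → ℝ) × (Fin (m + 1) → ℝ),
      ‖stft f g z.1 z.2‖ₑ * ENNReal.ofReal (stWeight q b (z.2 0)) < ⊤) :
    f =ᵐ[volume] 0 ∨ g =ᵐ[volume] 0 := by
  have : (volume : Measure ((Fin (m + 1) → ℝ) × (Fin (m + 1) → ℝ))).IsAddLeftInvariant := by
    rw [Measure.volume_eq_prod]; infer_instance
  apply ae_eq_zero_or_of_stft hf hg hfm hgm
  have hVm := measurable_stft hfm hgm
  have hVi : Integrable fun z : (Fin (m + 1) → ℝ) × (Fin (m + 1) → ℝ) => stft f g z.1 z.2 := by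
    refine ⟨hVm.aestronglyMeasurable, lt_of_le_of_lt (lintegral_mono fun z => ?_) hx⟩
    exact le_mul_of_one_le_right' (by
      rw [ENNReal.one_le_ofReal]; exact one_le_stWeight hpq.pos ha _)
  have hgood : ∀ᵐ x, Integrable (stft f g x) := by
    rw [Measure.volume_eq_prod] at hVi
    exact hVi.prod_right_ae
  have hm1 : Measurable fun z : (Fin (m + 1) → ℝ) × (Fin (m + 1) → ℝ) =>
      ‖stft f g z.1 z.2‖ₑ * ENNReal.ofReal (stWeight p a (z.1 0)) := by fun_prop
  have hm2 : Measurable fun z : (Fin (m + 1) → ℝ) × (Fin (m + 1) → ℝ) =>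
      ‖stft f g z.1 z.2‖ₑ * ENNReal.ofReal (stWeight q b (z.2 0)) := by fun_prop
  have key : ∀ᵐ c : (Fin (m + 1) → ℝ) × (Fin (m + 1) → ℝ),
      ∀ᵐ z : (Fin (m + 1) → ℝ) × (Fin (m + 1) → ℝ),
        reflectedProduct f g ((1 / 2 : ℝ) • c) z.1 z.2 = 0 := by
    filter_upwards [ae_lintegral_half_add_mul_half_sub_lt_top hm1 hx,
      ae_lintegral_half_add_mul_half_sub_lt_top hm2 hω] with c hc1 hc2
    set w := (1 / 2 : ℝ) • c
    have hrm := measurable_reflectedProduct hfm hgm w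
    have hbound : ∀ (r e : ℝ) (_ : 1 ≤ r) (_ : 0 < e) (s t : ℝ) (z : (Fin (m + 1) → ℝ) × (Fin (m + 1) → ℝ)),
        ‖gsWeight r e t • reflectedProduct f g w z.1 z.2‖ₑ ≤
          ‖stft f g (w + z).1 (w + z).2‖ₑ * ENNReal.ofReal (stWeight r e (s + t)) *
          (‖stft f g (w - z).1 (w - z).2‖ₑ * ENNReal.ofReal (stWeight r e (s - t))) := by
      intro r e hr he s t z
      rw [enorm_smul, reflectedProduct, enorm_mul, enorm_mul, ← ofReal_norm (chr _), norm_chr,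
        ENNReal.ofReal_one, mul_one, Real.enorm_eq_ofReal (gsWeight_pos _ _ _).le]
      calc _ ≤ ENNReal.ofReal (stWeight r e (s + t) * stWeight r e (s - t)) *
            (‖stft f g (w.1 + z.1) (w.2 + z.2)‖ₑ * ‖stft f g (w.1 - z.1) (w.2 - z.2)‖ₑ) := by
            gcongr
            exact gsWeight_le_stWeight_mul hr he s t
        _ = _ := by
            rw [ENNReal.ofReal_mul (stWeight_pos _ _ _).le]
            simp only [Prod.fst_add, Prod.snd_add, Prod.fst_sub, Prod.snd_sub]
            ring
    refine ae_eq_zero_of_symmetric_transform hpq ha hb hab hrm ?_ ?_ ?_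
    · have hgood' := ((volume : Measure (Fin (m + 1) → ℝ)).measurePreserving_sub_left w.1).quasiMeasurePreserving.ae hgood
      filter_upwards [hgood'] with u hu
      filter_upwards [hgood'] with x hx
      exact integral_reflectedProduct_symm hf hg w hu hx
    · refine ⟨Measurable.aestronglyMeasurable (by fun_prop), lt_of_le_of_lt (lintegral_mono fun z => ?_) hc1⟩
      exact hbound p a hpq.lt.le ha (w.1 0) (z.1 0) z
    · refine ⟨Measurable.aestronglyMeasurable (by fun_prop), lt_of_le_of_lt (lintegral_mono fun z => ?_) hc2⟩
      exact hbound q b hpq.symm.lt.le hb (w.2 0) (z.2 0) z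
  set N : (Fin (m + 1) → ℝ) × (Fin (m + 1) → ℝ) → ENNReal := fun z => ‖stft f g z.1 z.2‖ₑ with hN
  have hNm : Measurable N := by fun_prop
  -- The total integral of `N ∗ N` is the square of the integral of `N`, so vanishing for almost
  -- every centre forces `N = 0`.
  have hzero : ∫⁻ c, ∫⁻ z, N z * N (c - z) = 0 := by
    rw [← lintegral_zero (μ := (volume : Measure ((Fin (m + 1) → ℝ) × (Fin (m + 1) → ℝ))))]
    refine lintegral_congr_ae ?_
    filter_upwards [key] with c hc
    rw [← lintegral_half_add_mul_half_sub,
      ← lintegral_zero (μ := (volume : Measure ((Fin (m + 1) → ℝ) × (Fin (m + 1) → ℝ))))]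
    refine lintegral_congr_ae ?_
    filter_upwards [hc] with z hz
    have h1 := congrArg (fun y : ℂ => ‖y‖ₑ) hz
    simp only [reflectedProduct, enorm_mul, enorm_zero, ← ofReal_norm (chr _), norm_chr,
      ENNReal.ofReal_one, mul_one] at h1
    exact h1
  rw [lintegral_lintegral_mul_sub hNm hNm, mul_self_eq_zero, lintegral_eq_zero_iff hNm] at hzero
  filter_upwards [hzero] with z hz
  simpa [hN] using hz

/-! ### Slicing: from the partial transform to the full one. -/

theorem ae_or_of_ae_ae_or {A B : Type*} [MeasurableSpace A] [MeasurableSpace B] {μ : Measure A}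
    {ν : Measure B} {P : A → Prop} {Q : B → Prop} (h : ∀ᵐ x ∂μ, ∀ᵐ y ∂ν, P x ∨ Q y) :
    (∀ᵐ x ∂μ, P x) ∨ ∀ᵐ y ∂ν, Q y := by
  by_cases hQ : ∀ᵐ y ∂ν, Q y
  · exact Or.inr hQ
  · refine Or.inl (h.mono fun x hx => ?_)
    by_contra hP
    exact hQ (hx.mono fun y hy => hy.resolve_left hP)

section fubini
variable {A B C D : Type*} [MeasureSpace A] [MeasureSpace B] [MeasureSpace C] [MeasureSpace D]
  [SFinite (volume : Measure B)] [SFinite (volume : Measure C)]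
  [SFinite (volume : Measure D)]

/-- `A` and `C` hold the frozen variables `x₂` and `ω₂`; Tonelli moves the integral over `C` outside
that over `B`. -/
theorem ae_ae_lintegral_lt_top {Φ : (A × B) × (C × D) → ENNReal} (hΦ : Measurable Φ)
    (h : ∫⁻ z, Φ z < ⊤) :
    ∀ᵐ x : A, ∀ᵐ y : C, ∫⁻ z : B × D, Φ ((x, z.1), (y, z.2)) < ⊤ := by
  simp only [Measure.volume_eq_prod] at h ⊢
  rw [lintegral_prod _ hΦ.aemeasurable] at h
  have h1 : Measurable fun w : A × B => ∫⁻ v : C × D, Φ (w, v) ∂(volume.prod volume) :=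
    hΦ.lintegral_prod_right'
  rw [lintegral_prod _ h1.aemeasurable] at h
  filter_upwards [ae_lt_top h1.lintegral_prod_right' h.ne] with x hx
  have h2 : Measurable fun w : B × (C × D) => Φ ((x, w.1), w.2) := hΦ.comp (by fun_prop)
  have h3 : Measurable fun w : B × C => ∫⁻ v : D, Φ ((x, w.1), (w.2, v)) :=
    Measurable.lintegral_prod_right' (f := fun y : (B × C) × D => Φ ((x, y.1.1), (y.1.2, y.2)))
      (hΦ.comp (by fun_prop))
  have e : ∫⁻ w : B, ∫⁻ v : C × D, Φ ((x, w), v) ∂(volume.prod volume) =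
      ∫⁻ y : C, ∫⁻ w : B, ∫⁻ v : D, Φ ((x, w), (y, v)) := by
    rw [lintegral_lintegral_swap (f := fun y w => ∫⁻ v : D, Φ ((x, w), (y, v)))
      (h3.comp measurable_swap).aemeasurable]
    congr 1 with w
    exact lintegral_prod _ (hΦ.comp (by fun_prop : Measurable fun v : C × D => ((x, w), v))).aemeasurable
  rw [e] at hx
  have h4 : Measurable fun y : C => ∫⁻ w : B, ∫⁻ v : D, Φ ((x, w), (y, v)) :=
    Measurable.lintegral_prod_right' (f := fun y : C × B => ∫⁻ v : D, Φ ((x, y.2), (y.1, v)))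
      (h3.comp measurable_swap)
  filter_upwards [ae_lt_top h4 hx.ne] with y hy
  rw [lintegral_prod]
  · exact hy
  · exact (hΦ.comp (by fun_prop : Measurable fun z : B × D => ((x, z.1), (y, z.2)))).aemeasurable

end fubini

section split
variable {d k : ℕ}

/-- Splitting `ℝᵈ` into the last `d - k` and the first `k` coordinates. -/
noncomputable def splitEquiv (hk : k ≤ d) :
    ({i : Fin d // ¬ (i : ℕ) < k} → ℝ) × (Fin k → ℝ) ≃ᵐ (Fin d → ℝ) :=
  (MeasurableEquiv.prodComm.trans ((MeasurableEquiv.arrowCongr'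
    (⟨fun i => ⟨Fin.castLE hk i, i.2⟩, fun j => ⟨j.1, j.2⟩, fun _ => rfl, fun _ => rfl⟩ :
      Fin k ≃ {i : Fin d // (i : ℕ) < k}) (MeasurableEquiv.refl ℝ)).prodCongr
    (MeasurableEquiv.refl _))).trans
  (MeasurableEquiv.piEquivPiSubtypeProd (fun _ : Fin d => ℝ) (fun i => (i : ℕ) < k)).symm

theorem measurePreserving_splitEquiv (hk : k ≤ d) : MeasurePreserving (splitEquiv hk) := by
  have h1 := (volume_preserving_piEquivPiSubtypeProd (fun _ : Fin d => ℝ)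
    (fun i => (i : ℕ) < k)).symm
  have h2 := volume_preserving_arrowCongr'
    (⟨fun i => ⟨Fin.castLE hk i, i.2⟩, fun j => ⟨j.1, j.2⟩, fun _ => rfl, fun _ => rfl⟩ :
      Fin k ≃ {i : Fin d // (i : ℕ) < k}) (MeasurableEquiv.refl ℝ) (MeasurePreserving.id volume)
  have h3 := h2.prod (MeasurePreserving.id (volume : Measure ({i : Fin d // ¬ (i : ℕ) < k} → ℝ)))
  exact (h1.comp h3).comp Measure.measurePreserving_swap

theorem splitEquiv_apply (hk : k ≤ d) (w : ({i : Fin d // ¬ (i : ℕ) < k} → ℝ) × (Fin k → ℝ))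
    (i : Fin d) : splitEquiv hk w i = if h : (i : ℕ) < k then w.2 ⟨i, h⟩ else w.1 ⟨i, h⟩ := rfl

theorem splitEquiv_castLE (hk : k ≤ d) (w : ({i : Fin d // ¬ (i : ℕ) < k} → ℝ) × (Fin k → ℝ))
    (i : Fin k) : splitEquiv hk w (Fin.castLE hk i) = w.2 i := by
  rw [splitEquiv_apply]; simp

theorem firstPart_splitEquiv (hk : k ≤ d)
    (w : ({i : Fin d // ¬ (i : ℕ) < k} → ℝ) × (Fin k → ℝ)) :
    PartialSTFT.firstPart hk (splitEquiv hk w) = w.2 :=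
  funext fun i => splitEquiv_castLE hk w i

theorem glue_splitEquiv (hk : k ≤ d) (t : Fin k → ℝ)
    (w : ({i : Fin d // ¬ (i : ℕ) < k} → ℝ) × (Fin k → ℝ)) :
    PartialSTFT.glue t (splitEquiv hk w) = splitEquiv hk (w.1, t) := by
  ext i
  simp only [PartialSTFT.glue, splitEquiv_apply]
  split_ifs <;> rfl

theorem neg_splitEquiv (hk : k ≤ d) (w : ({i : Fin d // ¬ (i : ℕ) < k} → ℝ) × (Fin k → ℝ)) :
    -splitEquiv hk w = splitEquiv hk (-w) := by
  ext i
  simp only [Pi.neg_apply, splitEquiv_apply]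
  split_ifs <;> rfl

theorem partialSTFT_splitEquiv (hk : k ≤ d) (f g : (Fin d → ℝ) → ℂ)
    (z w : ({i : Fin d // ¬ (i : ℕ) < k} → ℝ) × (Fin k → ℝ)) :
    PartialSTFT.partialSTFT hk g f (splitEquiv hk z) (splitEquiv hk w) =
      stft (fun t => f (splitEquiv hk (z.1, t))) (fun t => g (splitEquiv hk (-w.1, t))) z.2 w.2 := by
  simp only [PartialSTFT.partialSTFT, stft, glue_splitEquiv, firstPart_splitEquiv, neg_splitEquiv,
    Prod.fst_neg]
  congr 1 with t
  rw [chr, dotProduct]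
  push_cast
  ring_nf

theorem ae_splitEquiv_iff (hk : k ≤ d) {P : (Fin d → ℝ) → Prop} :
    (∀ᵐ w, P (splitEquiv hk w)) ↔ ∀ᵐ x, P x := by
  refine ⟨fun h => ?_, fun h => (measurePreserving_splitEquiv hk).quasiMeasurePreserving.ae h⟩
  have := (measurePreserving_splitEquiv hk).symm.quasiMeasurePreserving.ae h
  simpa using this

theorem ae_memLp_splitEquiv (hk : k ≤ d) {f : (Fin d → ℝ) → ℂ} (hf : MemLp f 2)
    (hfm : Measurable f) : ∀ᵐ y, MemLp (fun t => f (splitEquiv hk (y, t))) 2 := by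
  have h1 := (memLp_two_iff_integrable_sq_norm
    ((hfm.comp (splitEquiv hk).measurable).aestronglyMeasurable)).mp
      (hf.comp_measurePreserving (measurePreserving_splitEquiv hk))
  rw [Measure.volume_eq_prod] at h1
  filter_upwards [h1.prod_right_ae] with y hy
  exact (memLp_two_iff_integrable_sq_norm
    (hfm.comp ((splitEquiv hk).measurable.comp (by fun_prop))).aestronglyMeasurable).mpr hy

theorem ae_eq_zero_of_ae_splitEquiv (hk : k ≤ d) {f : (Fin d → ℝ) → ℂ} (hfm : Measurable f)
    (h : ∀ᵐ y, (fun t => f (splitEquiv hk (y, t))) =ᵐ[volume] 0) : f =ᵐ[volume] 0 := by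
  refine (ae_splitEquiv_iff hk).mp ?_
  rw [Measure.volume_eq_prod]
  exact (Measure.ae_prod_iff_ae_ae
    ((hfm.comp (splitEquiv hk).measurable) (measurableSet_singleton 0))).mpr h

theorem ae_ae_of_ae_splitEquiv (hk : k ≤ d) {P : (Fin d → ℝ) → Prop} (h : ∀ᵐ x, P x) :
    ∀ᵐ y, ∀ᵐ t, P (splitEquiv hk (y, t)) := by
  have h1 := (ae_splitEquiv_iff hk).mpr h
  rw [Measure.volume_eq_prod] at h1
  exact Measure.ae_ae_of_ae_prod h1

theorem stWeight_le_exp_lpNormPow {p a : ℝ} (hp : 0 < p) (ha : 0 < a) (x : Fin d → ℝ) (i : Fin d) :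
    stWeight p a (x i) ≤ Real.exp (Real.pi / p * a ^ p * PartialSTFT.lpNormPow p x) := by
  have := Real.pi_pos
  rw [stWeight]
  gcongr
  exact Finset.single_le_sum (f := fun i => |x i| ^ p) (fun i _ => by positivity) (Finset.mem_univ i)

/-- Transfer of a weighted bound for the partial transform to the split coordinates, for functions
equal almost everywhere to the given ones. -/
theorem lintegral_stft_splitEquiv_lt_top (hk : k ≤ d) {f g f' g' : (Fin d → ℝ) → ℂ}
    (hff : f =ᵐ[volume] f') (hgg : g =ᵐ[volume] g') {W : (Fin d → ℝ) × (Fin d → ℝ) → ENNReal}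
    {U : (({i : Fin d // ¬ (i : ℕ) < k} → ℝ) × (Fin k → ℝ)) ×
      (({i : Fin d // ¬ (i : ℕ) < k} → ℝ) × (Fin k → ℝ)) → ENNReal}
    (hUW : ∀ z, U z ≤ W (splitEquiv hk z.1, splitEquiv hk z.2))
    (h : ∫⁻ z : (Fin d → ℝ) × (Fin d → ℝ), ‖PartialSTFT.partialSTFT hk g f z.1 z.2‖ₑ * W z < ⊤) :
    ∫⁻ z, ‖stft (fun t => f' (splitEquiv hk (z.1.1, t))) (fun t => g' (splitEquiv hk (-z.2.1, t)))
      z.1.2 z.2.2‖ₑ * U z < ⊤ := by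
  have hp : MeasurePreserving ((splitEquiv hk).prodCongr (splitEquiv hk)) :=
    (measurePreserving_splitEquiv hk).prod (measurePreserving_splitEquiv hk)
  -- Changing variables along a measurable embedding asks no measurability of the integrand, which
  -- is built from `f` and `g` that are only almost everywhere measurable.
  rw [← hp.lintegral_comp_emb (MeasurableEquiv.measurableEmbedding _)] at h
  refine lt_of_le_of_lt (lintegral_mono_ae ?_) h
  have h1 : ∀ᵐ z : (({i : Fin d // ¬ (i : ℕ) < k} → ℝ) × (Fin k → ℝ)) ×
      (({i : Fin d // ¬ (i : ℕ) < k} → ℝ) × (Fin k → ℝ)),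
      ∀ᵐ t, f (splitEquiv hk (z.1.1, t)) = f' (splitEquiv hk (z.1.1, t)) := by
    have q := (Measure.quasiMeasurePreserving_fst (μ := (volume : Measure
      ({i : Fin d // ¬ (i : ℕ) < k} → ℝ))) (ν := (volume : Measure (Fin k → ℝ)))).comp
      (Measure.quasiMeasurePreserving_fst (μ := (volume : Measure
        (({i : Fin d // ¬ (i : ℕ) < k} → ℝ) × (Fin k → ℝ)))) (ν := (volume : Measure
        (({i : Fin d // ¬ (i : ℕ) < k} → ℝ) × (Fin k → ℝ)))))
    exact q.ae (ae_ae_of_ae_splitEquiv hk hff)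
  have h2 : ∀ᵐ z : (({i : Fin d // ¬ (i : ℕ) < k} → ℝ) × (Fin k → ℝ)) ×
      (({i : Fin d // ¬ (i : ℕ) < k} → ℝ) × (Fin k → ℝ)),
      ∀ᵐ t, g (splitEquiv hk (-z.2.1, t)) = g' (splitEquiv hk (-z.2.1, t)) := by
    have q := (Measure.quasiMeasurePreserving_fst (μ := (volume : Measure
      ({i : Fin d // ¬ (i : ℕ) < k} → ℝ))) (ν := (volume : Measure (Fin k → ℝ)))).comp
      (Measure.quasiMeasurePreserving_snd (μ := (volume : Measure
        (({i : Fin d // ¬ (i : ℕ) < k} → ℝ) × (Fin k → ℝ)))) (ν := (volume : Measure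
        (({i : Fin d // ¬ (i : ℕ) < k} → ℝ) × (Fin k → ℝ)))))
    exact q.ae ((Measure.measurePreserving_neg (volume : Measure
      ({i : Fin d // ¬ (i : ℕ) < k} → ℝ))).quasiMeasurePreserving.ae
        (ae_ae_of_ae_splitEquiv hk hgg))
  filter_upwards [h1, h2] with z hz1 hz2
  have e : PartialSTFT.partialSTFT hk g f (splitEquiv hk z.1) (splitEquiv hk z.2) =
      stft (fun t => f' (splitEquiv hk (z.1.1, t))) (fun t => g' (splitEquiv hk (-z.2.1, t)))
        z.1.2 z.2.2 := by
    rw [partialSTFT_splitEquiv]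
    refine integral_congr_ae ?_
    filter_upwards [hz1, (measurePreserving_sub_right (volume : Measure (Fin k → ℝ))
      z.1.2).quasiMeasurePreserving.ae hz2] with t ht1 ht2
    simp only [ht1, ht2]
  rw [← e]
  exact mul_le_mul_right (hUW z) _

theorem measurable_stft_splitEquiv (hk : k ≤ d) {f g : (Fin d → ℝ) → ℂ} (hf : Measurable f)
    (hg : Measurable g) :
    Measurable fun z : (({i : Fin d // ¬ (i : ℕ) < k} → ℝ) × (Fin k → ℝ)) ×
      (({i : Fin d // ¬ (i : ℕ) < k} → ℝ) × (Fin k → ℝ)) =>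
      stft (fun t => f (splitEquiv hk (z.1.1, t))) (fun t => g (splitEquiv hk (-z.2.1, t)))
        z.1.2 z.2.2 := by
  have hm := (splitEquiv hk).measurable
  have h1 : Measurable fun y : ((({i : Fin d // ¬ (i : ℕ) < k} → ℝ) × (Fin k → ℝ)) ×
      (({i : Fin d // ¬ (i : ℕ) < k} → ℝ) × (Fin k → ℝ))) × (Fin k → ℝ) =>
      f (splitEquiv hk (y.1.1.1, y.2)) := hf.comp (hm.comp (by fun_prop))
  have h2 : Measurable fun y : ((({i : Fin d // ¬ (i : ℕ) < k} → ℝ) × (Fin k → ℝ)) ×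
      (({i : Fin d // ¬ (i : ℕ) < k} → ℝ) × (Fin k → ℝ))) × (Fin k → ℝ) =>
      starRingEnd ℂ (g (splitEquiv hk (-y.1.2.1, y.2 - y.1.1.2))) :=
    Complex.continuous_conj.measurable.comp (hg.comp (hm.comp (by fun_prop)))
  have h3 : Measurable fun y : ((({i : Fin d // ¬ (i : ℕ) < k} → ℝ) × (Fin k → ℝ)) ×
      (({i : Fin d // ¬ (i : ℕ) < k} → ℝ) × (Fin k → ℝ))) × (Fin k → ℝ) =>
      chr (-(y.2 ⬝ᵥ y.1.2.2)) := Continuous.measurable (by fun_prop)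
  exact ((h1.mul h2).mul h3).stronglyMeasurable.integral_prod_right.measurable

end split

theorem theorem3p5 (d k : ℕ) (hk1 : 1 ≤ k) (hkd : k ≤ d)
    (p q : ℝ) (hp : 1 < p) (hpq : 1 / p + 1 / q = 1)
    (α β : ℝ) (hα : 0 < α) (hβ : 0 < β) (hαβ : 1 ≤ α * β)
    (f g : (Fin d → ℝ) → ℂ) (hf : MemLp f 2 volume) (hg : MemLp g 2 volume)
    (hx : ∫⁻ z : (Fin d → ℝ) × (Fin d → ℝ),
      ‖PartialSTFT.partialSTFT hkd g f z.1 z.2‖ₑ *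
        ENNReal.ofReal (Real.exp (Real.pi / p * α ^ p * PartialSTFT.lpNormPow p z.1)) < ⊤)
    (hω : ∫⁻ z : (Fin d → ℝ) × (Fin d → ℝ),
      ‖PartialSTFT.partialSTFT hkd g f z.1 z.2‖ₑ *
        ENNReal.ofReal (Real.exp (Real.pi / q * β ^ q * PartialSTFT.lpNormPow q z.2)) < ⊤) :
    f =ᵐ[volume] 0 ∨ g =ᵐ[volume] 0 := by
  obtain ⟨m, rfl⟩ : ∃ m, k = m + 1 := ⟨k - 1, by omega⟩
  have hc : p.HolderConjugate q := Real.holderConjugate_iff.mpr ⟨hp, by simpa using hpq⟩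
  -- Measurable representatives make the slices and their transforms jointly measurable, as Tonelli
  -- requires.
  obtain ⟨f', hf'm, hff⟩ := hf.1
  obtain ⟨g', hg'm, hgg⟩ := hg.1
  have hf' := hf.ae_eq hff
  have hg' := hg.ae_eq hgg
  replace hf'm := hf'm.measurable
  replace hg'm := hg'm.measurable
  suffices h : f' =ᵐ[volume] 0 ∨ g' =ᵐ[volume] 0 from h.imp hff.trans hgg.trans
  have hVm := measurable_stft_splitEquiv hkd hf'm hg'm
  have hx' := lintegral_stft_splitEquiv_lt_top hkd hff hgg
    (U := fun z => ENNReal.ofReal (stWeight p α (z.1.2 0))) (fun z => ENNReal.ofReal_le_ofReal (by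
      simpa only [splitEquiv_castLE] using
        stWeight_le_exp_lpNormPow hc.pos hα (splitEquiv hkd z.1) (Fin.castLE hkd 0))) hx
  have hω' := lintegral_stft_splitEquiv_lt_top hkd hff hgg
    (U := fun z => ENNReal.ofReal (stWeight q β (z.2.2 0))) (fun z => ENNReal.ofReal_le_ofReal (by
      simpa only [splitEquiv_castLE] using
        stWeight_le_exp_lpNormPow hc.symm.pos hβ (splitEquiv hkd z.2) (Fin.castLE hkd 0))) hω
  have hneg := (Measure.measurePreserving_neg (volume : Measure
    ({i : Fin d // ¬ (i : ℕ) < m + 1} → ℝ))).quasiMeasurePreserving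
  have key : ∀ᵐ y : {i : Fin d // ¬ (i : ℕ) < m + 1} → ℝ, ∀ᵐ η : {i : Fin d // ¬ (i : ℕ) < m + 1} → ℝ,
      (fun t => f' (splitEquiv hkd (y, t))) =ᵐ[volume] 0 ∨
        (fun t => g' (splitEquiv hkd (-η, t))) =ᵐ[volume] 0 := by
    filter_upwards [ae_ae_lintegral_lt_top (by fun_prop) hx', ae_ae_lintegral_lt_top (by fun_prop) hω',
      ae_memLp_splitEquiv hkd hf' hf'm] with y hy1 hy2 hy3
    -- The window is sliced at `-ω₂`, so its almost-everywhere statements are pulled back along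
    -- negation.
    filter_upwards [hy1, hy2, hneg.ae (ae_memLp_splitEquiv hkd hg' hg'm)] with η hη1 hη2 hη3
    exact stft_uncertainty hc hα hβ hαβ hy3 hη3
      (hf'm.comp ((splitEquiv hkd).measurable.comp (by fun_prop)))
      (hg'm.comp ((splitEquiv hkd).measurable.comp (by fun_prop))) hη1 hη2
  refine (ae_or_of_ae_ae_or key).imp (ae_eq_zero_of_ae_splitEquiv hkd hf'm) fun h => ?_
  refine ae_eq_zero_of_ae_splitEquiv hkd hg'm ?_
  filter_upwards [hneg.ae h] with y hy
  simpa using hy
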